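/- Write $\mathrm{tower}(r)=\exp(\exp(\cdots\exp(1)))$ with $\lfloor r\rfloor$ exponentials ($r\ge 0$), so $\mathrm{tower}(r)=1$ for $0\le r<1$. Let $[q]=\{1,\dots,q\}$. A shift of finite type on $\mathbb{Z}$ is a set $$S=S(q,k,W)=\{x\in[q]^{\mathbb{Z}} : (x_{i+1},\dots,x_{i+k})\in W\ \ \forall i\in\mathbb{Z}\}$$ with $W\subseteq[q]^k$. For $w\in W$ let $T(w)$ be the set of $t\ge 1$ for which some $x\in S$ satisfies $(x_1,\dots,x_k)=(x_{t+1},\dots,x_{t+k})=w$. The shift $S$ is called non-lattice if $\gcd T(w)=1$ for some $w\in W$. A process $X=(X_v)_{v\in\mathbb{Z}}$ is ffiid (a finitary factor of an iid process) if $X=F(Y)$ for some iid family $Y=(Y_v)_{v\in\mathbb{Z}}$ of random variables and some measurable map $F$ that commutes with all translations of $\mathbb{Z}$, such that for almost every $y$ (with respect to the law of $Y$) there is an $r<\infty$ with $F(y')_0=F(y)_0$ for all $y'$ that agree with $y$ on $\{v:|v|\le r\}$. The least such integer $r\ge 0$ is denoted $R(y)$, and $R=R(Y)$ is the coding radius.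 Theorem. Let $S$ be a shift of finite type on $\mathbb{Z}$. There are constants $c,C\in(0,\infty)$, depending only on $S$, such that the following hold. (i) If $S$ is non-lattice, then there exists an ffiid process $X$ with $X\in S$ almost surely, whose coding radius satisfies $\mathbb{P}(R>r)\le 1/\mathrm{tower}(cr)$ for all real $r>0$. (ii) If $S$ contains no constant configuration $(\cdots aaa\cdots)$, then for every ffiid process $X$ with $X\in S$ almost surely, the coding radius satisfies $\mathbb{P}(R>r)\ge 1/\mathrm{tower}(Cr)$ for all real $r>0$. -/

import Mathlib

open MeasureTheory ProbabilityTheory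
open scoped ENNReal

namespace FiniteType

/-- The tower function: the iterated exponential `exp (exp (⋯ (exp 1)))` with `⌊r⌋` exponentials. -/
noncomputable def tower (r : ℝ) : ℝ := Real.exp^[⌊r⌋₊] 1

/-- The pattern `(x_{i+1}, …, x_{i+k})` of the configuration `x`. -/
def pattern {A : Type*} (k : ℕ) (x : ℤ → A) (i : ℤ) : Fin k → A :=
  fun j => x (i + 1 + (j : ℕ))

/-- The shift of finite type `S(q, k, W)`: the configurations on `ℤ` with `q` symbols all of whose
patterns of length `k` are allowed, that is, lie in `W`. -/
def sft (q k : ℕ) (W : Set (Fin k → Fin q)) : Set (ℤ → Fin q) :=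
  {x | ∀ i : ℤ, pattern k x i ∈ W}

/-- The set `T(w)` of the times `t ≥ 1` at which the pattern `w` can recur in `S(q, k, W)`. -/
def recurrenceTimes (q k : ℕ) (W : Set (Fin k → Fin q)) (w : Fin k → Fin q) : Set ℕ :=
  {t | 1 ≤ t ∧ ∃ x ∈ sft q k W, pattern k x 0 = w ∧ pattern k x (t : ℤ) = w}

/-- `S(q, k, W)` is non-lattice if the recurrence times of some allowed pattern have greatest
common divisor `1`. -/
def NonLattice (q k : ℕ) (W : Set (Fin k → Fin q)) : Prop :=
  ∃ w ∈ W, Nat.setGcd (recurrenceTimes q k W w) = 1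

/-- The translation of `ℤ` by `t`, acting on configurations. -/
def translate {A : Type*} (t : ℤ) (y : ℤ → A) : ℤ → A := fun v => y (v - t)

/-- The restriction of `y` to the ball `{v | |v| ≤ r}` determines the value of `F` at the origin. -/
def DeterminedBy {A B : Type*} (F : (ℤ → B) → ℤ → A) (y : ℤ → B) (r : ℕ) : Prop :=
  ∀ y' : ℤ → B, (∀ v : ℤ, |v| ≤ (r : ℤ) → y' v = y v) → F y' 0 = F y 0

/-- The coding radius of `F` at `y`: the least `r` such that the restriction of `y` to the ball of
radius `r` determines the value of `F` at the origin (and `⊤` if there is none). -/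
noncomputable def codingRadius {A B : Type*} (F : (ℤ → B) → ℤ → A) (y : ℤ → B) : ℕ∞ :=
  ⨅ (r : ℕ) (_ : DeterminedBy F y r), (r : ℕ∞)

/-- The joint law of a family of random variables indexed by `ℤ`. -/
noncomputable def law {Ω B : Type*} [MeasurableSpace Ω] [MeasurableSpace B] (P : Measure Ω)
    (Y : ℤ → Ω → B) : Measure (ℤ → B) :=
  P.map (fun ω v => Y v ω)

/-- The process `X`, defined on the probability space `(Ω, P)`, is the finitary factor `F(Y)` of the
iid family `Y`. -/
structure IsFFIID {Ω A B : Type*} [MeasurableSpace Ω] [MeasurableSpace A] [MeasurableSpace B]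
    (P : Measure Ω) (X : Ω → ℤ → A) (Y : ℤ → Ω → B) (F : (ℤ → B) → ℤ → A) : Prop where
  isProbabilityMeasure : IsProbabilityMeasure P
  measurable : ∀ v, Measurable (Y v)
  indep : iIndepFun Y P
  identDistrib : ∀ u v, IdentDistrib (Y u) (Y v) P P
  measurable_map : Measurable F
  equivariant : ∀ (t : ℤ) (y : ℤ → B), F (translate t y) = translate t (F y)
  eq_map : ∀ ω, X ω = F (fun v => Y v ω)
  finitary : ∀ᵐ y ∂(law P Y), codingRadius F y < ⊤

/-- The tail probability `ℙ(R > r)` of the coding radius `R = codingRadius F Y`. -/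
noncomputable def tail {Ω A B : Type*} [MeasurableSpace Ω] [MeasurableSpace B]
    (P : Measure Ω) (Y : ℤ → Ω → B) (F : (ℤ → B) → ℤ → A) (r : ℝ) : ℝ :=
  (law P Y).real {y | ENNReal.ofReal r < ((codingRadius F y : ℕ∞) : ℝ≥0∞)}

end FiniteType

/-! Lower bound. Call a symbol sure at a site if, given the labels within distance `n`, it is almost
surely the output there. The sets of sure symbols at `k + 1` consecutive sites form a block factor
of block length `2 * n + 1 + k`, over an alphabet whose size does not depend on `n`. A block factor
cannot avoid taking equal values at adjacent positions (`blockBound_le_measure_eq`): replacing each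
value by the set of values that are likely given all but the last label shortens the block by one
and turns `Q` values into `2 ^ Q`. After as many steps as the block is long, the probability of a
coincidence is still at least an inverse tower. A coincidence makes the sure sets agree along a run
of sites; a common sure symbol would fill a whole pattern and put a constant configuration in the
shift. So the sure set is empty and the coding radius exceeds `n`.

Upper bound. The recurrence times of a suitable `w` contain all large integers, so it suffices to
place copies of `w` at gaps between `N` and `2 * N` and to fill the gaps with loops. The copies sit
on a maximal `N`-separated set. To build it, each site takes the first level `j` at which its random
colour, out of a tower-sized palette, differs from those of its neighbours. Cole–Vishkin reduction
then needs only `j` steps to reach 8 colours. Level and reduced colours give a rank that separates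
nearby sites, and greedy selection by rank looks only at distances linear in the level
(`selected_congr`). A level above `L` has probability of order `1 / paletteSize L`, which is an
inverse tower. -/

namespace FiniteType

/-! ### Resampling coordinates of an iid family -/

section Resampling

variable {B : Type*}

open Classical in
/-- The configuration that agrees with `y` on `s` and with `y'` off `s`. -/
noncomputable def mix (s : Set ℤ) (y y' : ℤ → B) : ℤ → B := s.piecewise y y'

lemma mix_of_mem {s : Set ℤ} {y y' : ℤ → B} {v : ℤ} (hv : v ∈ s) : mix s y y' v = y v := by
  simp [mix, hv]

lemma mix_of_notMem {s : Set ℤ} {y y' : ℤ → B} {v : ℤ} (hv : v ∉ s) : mix s y y' v = y' v := by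
  simp [mix, hv]

lemma mix_congr {s : Set ℤ} {y₁ y₂ : ℤ → B} (h : ∀ v ∈ s, y₁ v = y₂ v) (y' : ℤ → B) :
    mix s y₁ y' = mix s y₂ y' := by
  ext v
  by_cases hv : v ∈ s
  · simp only [mix_of_mem hv, h v hv]
  · simp only [mix_of_notMem hv]

lemma translate_translate (s t : ℤ) (y : ℤ → B) :
    translate s (translate t y) = translate (t + s) y := by
  ext v
  simp only [translate]
  congr 1
  ring

variable [MeasurableSpace B]

/-- The law of an iid family indexed by `ℤ` with marginal `μ`. -/
noncomputable abbrev iidLaw (μ : Measure B) : Measure (ℤ → B) :=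
  Measure.infinitePi fun _ : ℤ => μ

lemma measurable_mix (s : Set ℤ) :
    Measurable fun p : (ℤ → B) × (ℤ → B) => mix s p.1 p.2 := by
  refine measurable_pi_lambda _ fun v => ?_
  by_cases hv : v ∈ s
  · simp only [mix_of_mem hv]
    fun_prop
  · simp only [mix_of_notMem hv]
    fun_prop

variable (μ : Measure B) [IsProbabilityMeasure μ]

lemma measurePreserving_mix (s : Set ℤ) :
    MeasurePreserving (fun p : (ℤ → B) × (ℤ → B) => mix s p.1 p.2)
      ((iidLaw μ).prod (iidLaw μ)) (iidLaw μ) := by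
  classical
  refine ⟨measurable_mix s, Measure.eq_infinitePi _ fun t u hu => ?_⟩
  have hpre : (fun p : (ℤ → B) × (ℤ → B) => mix s p.1 p.2) ⁻¹' (Set.pi t u) =
      (Set.pi (t.filter (· ∈ s) : Finset ℤ) u) ×ˢ (Set.pi (t.filter (· ∉ s) : Finset ℤ) u) := by
    ext p
    simp only [Set.mem_preimage, Set.mem_pi, Set.mem_prod, Finset.coe_filter, Set.mem_ofPred_eq,
      Finset.mem_coe]
    constructor
    · intro h
      refine ⟨fun i hi => ?_, fun i hi => ?_⟩
      · simpa only [mix_of_mem hi.2] using h i hi.1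
      · simpa only [mix_of_notMem hi.2] using h i hi.1
    · rintro ⟨h₁, h₂⟩ i hi
      by_cases his : i ∈ s
      · simpa only [mix_of_mem his] using h₁ i ⟨hi, his⟩
      · simpa only [mix_of_notMem his] using h₂ i ⟨hi, his⟩
  rw [Measure.map_apply (measurable_mix s) (MeasurableSet.pi t.countable_toSet fun i _ => hu i),
    hpre, Measure.prod_prod, Measure.infinitePi_pi _ fun i _ => hu i,
    Measure.infinitePi_pi _ fun i _ => hu i]
  exact Finset.prod_filter_mul_prod_filter_not t (· ∈ s) _

lemma measurePreserving_translate (t : ℤ) :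
    MeasurePreserving (translate t : (ℤ → B) → ℤ → B) (iidLaw μ) (iidLaw μ) := by
  have hm : Measurable (translate t : (ℤ → B) → ℤ → B) :=
    measurable_pi_lambda _ fun v => measurable_pi_apply _
  refine ⟨hm, ?_⟩
  exact Measure.map_infinitePi_infinitePi_of_inj (P := fun _ : ℤ => μ)
    (sub_left_injective (b := t))

/-- Resampling the coordinates off `s`. -/
lemma iidLaw_apply_mix (s : Set ℤ) {E : Set (ℤ → B)} (hE : MeasurableSet E) :
    iidLaw μ E = ∫⁻ y, iidLaw μ {y' | mix s y y' ∈ E} ∂iidLaw μ := by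
  rw [← (measurePreserving_mix μ s).measure_preimage hE.nullMeasurableSet,
    Measure.prod_apply (measurable_mix s hE)]
  rfl

lemma measurable_measure_mix (s : Set ℤ) {E : Set (ℤ → B)} (hE : MeasurableSet E) :
    Measurable fun y => iidLaw μ {y' | mix s y y' ∈ E} :=
  measurable_measure_prodMk_left (measurable_mix s hE)

lemma iidLaw_preimage_translate (t : ℤ) {E : Set (ℤ → B)} (hE : MeasurableSet E) :
    iidLaw μ (translate t ⁻¹' E) = iidLaw μ E :=
  (measurePreserving_translate μ t).measure_preimage hE.nullMeasurableSet

end Resampling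

/-! ### Coincidences of adjacent values in block factors -/

section BlockFactor

/-- A lower bound for the probability that two adjacent values of a block factor of an iid
process, with blocks of length `m` and with `Q` values, coincide. -/
noncomputable def blockBound : ℕ → ℕ → ℝ
  | 0, _ => 1
  | m + 1, Q => blockBound m (2 ^ Q) ^ 2 / (4 * Q)

lemma blockBound_pos (m : ℕ) {Q : ℕ} (hQ : 0 < Q) : 0 < blockBound m Q := by
  induction m generalizing Q with
  | zero => simp [blockBound]
  | succ m ih =>
    have := ih (Q := 2 ^ Q) (by positivity)
    rw [blockBound]
    positivity

variable {B : Type*}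

/-- Seen from one site further right, the known window loses its last coordinate: within a block of
length `m + 1`, only the final label is fresh. -/
lemma shift_mix (m : ℕ) (y y' : ℤ → B) (v : ℤ) (hv : v ∈ Set.Ico (0 : ℤ) (m + 1 : ℕ)) :
    translate (-1) (mix (Set.Ico 0 ((m + 1 : ℕ) : ℤ)) y y') v =
      mix (Set.Ico 0 (m : ℤ)) (translate (-1) y) (translate (-1) y') v := by
  simp only [Set.mem_Ico] at hv
  push_cast at hv
  by_cases h : v < m
  · rw [mix_of_mem (Set.mem_Ico.2 ⟨hv.1, h⟩), translate, mix_of_mem]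
    · rfl
    · simp only [Set.mem_Ico]
      push_cast
      omega
  · rw [mix_of_notMem (fun h' => h h'.2), translate, mix_of_notMem]
    · rfl
    · simp only [Set.mem_Ico]
      push_cast
      omega

variable [MeasurableSpace B] (μ : Measure B)

/-- The values of `φ` whose conditional probability given the coordinates in `s` exceeds `δ`. -/
noncomputable def likelyValues {κ : Type*} [Fintype κ] (φ : (ℤ → B) → κ) (s : Set ℤ) (δ : ℝ≥0∞)
    (y : ℤ → B) : Finset κ :=
  open Classical in Finset.univ.filter fun a => δ < iidLaw μ {y' | φ (mix s y y') = a}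

variable {κ : Type*} [Fintype κ] {φ : (ℤ → B) → κ}

lemma mem_likelyValues {s : Set ℤ} {δ : ℝ≥0∞} {y : ℤ → B} {a : κ} :
    a ∈ likelyValues μ φ s δ y ↔ δ < iidLaw μ {y' | φ (mix s y y') = a} := by
  simp [likelyValues]

lemma likelyValues_congr {s : Set ℤ} {δ : ℝ≥0∞} {y₁ y₂ : ℤ → B} (h : ∀ v ∈ s, y₁ v = y₂ v) :
    likelyValues μ φ s δ y₁ = likelyValues μ φ s δ y₂ := by
  ext a
  simp only [mem_likelyValues, mix_congr h]

variable [IsProbabilityMeasure μ]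

lemma measurableSet_likelyValues (hφ : ∀ a, MeasurableSet {y | φ y = a}) (s : Set ℤ) (δ : ℝ≥0∞)
    (A : Finset κ) : MeasurableSet {y | likelyValues μ φ s δ y = A} := by
  have : {y | likelyValues μ φ s δ y = A} =
      ⋂ a : κ, {y | δ < iidLaw μ {y' | mix s y y' ∈ {y | φ y = a}} ↔ a ∈ A} := by
    ext y
    simp only [Finset.ext_iff, mem_likelyValues, Set.mem_iInter, Set.mem_ofPred_eq]
  rw [this]
  refine MeasurableSet.iInter fun a => ?_
  have hm : MeasurableSet {y | δ < iidLaw μ {y' | mix s y y' ∈ {y | φ y = a}}} :=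
    measurableSet_lt measurable_const (measurable_measure_mix μ s (hφ a))
  by_cases ha : a ∈ A
  · simpa only [ha, iff_true] using hm
  · simp only [ha, iff_false]
    exact hm.compl

lemma measurableSet_eq_comp {α β : Type*} [MeasurableSpace α] [Finite β] {f g : α → β}
    (hf : ∀ a, MeasurableSet {y | f y = a}) (hg : ∀ a, MeasurableSet {y | g y = a}) :
    MeasurableSet {y | f y = g y} := by
  have : {y | f y = g y} = ⋃ a, {y | f y = a} ∩ {y | g y = a} := by
    ext y
    simp [eq_comm]
  rw [this]
  exact MeasurableSet.iUnion fun a => (hf a).inter (hg a)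

lemma measurableSet_mem_comp {α β : Type*} [MeasurableSpace α] [Finite β] {f : α → β}
    {g : α → Finset β} (hf : ∀ a, MeasurableSet {y | f y = a})
    (hg : ∀ a, MeasurableSet {y | g y = a}) :
    MeasurableSet {y | f y ∈ g y} := by
  have : {y | f y ∈ g y} = ⋃ (A : Finset β) (a : A), {y | f y = a} ∩ {y | g y = A} := by
    ext y
    simp
  rw [this]
  exact MeasurableSet.iUnion fun A => MeasurableSet.iUnion fun a => (hf a).inter (hg A)

/-- Union bound: given the labels in `s`, each unlikely value has conditional probability at most
`δ`. -/
lemma measure_notMem_likelyValues_le (hφ : ∀ a, MeasurableSet {y | φ y = a}) (s : Set ℤ)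
    (δ : ℝ≥0∞) :
    iidLaw μ {y | φ y ∉ likelyValues μ φ s δ y} ≤ Fintype.card κ * δ := by
  classical
  have hm : MeasurableSet {y | φ y ∉ likelyValues μ φ s δ y} :=
    (measurableSet_mem_comp hφ (measurableSet_likelyValues μ hφ s δ)).compl
  rw [iidLaw_apply_mix μ s hm]
  calc ∫⁻ y, iidLaw μ {y' | mix s y y' ∈ {y | φ y ∉ likelyValues μ φ s δ y}} ∂iidLaw μ
      ≤ ∫⁻ _, Fintype.card κ * δ ∂iidLaw μ := ?_
    _ = Fintype.card κ * δ := by simp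
  refine lintegral_mono fun y => ?_
  have hsub : {y' | mix s y y' ∈ {y | φ y ∉ likelyValues μ φ s δ y}} ⊆
      ⋃ a ∈ Finset.univ.filter (· ∉ likelyValues μ φ s δ y), {y' | φ (mix s y y') = a} := by
    intro y' hy'
    simp only [Set.mem_ofPred_eq] at hy'
    rw [likelyValues_congr μ (y₂ := y) fun v hv => mix_of_mem hv] at hy'
    simpa using hy'
  calc iidLaw μ {y' | mix s y y' ∈ {y | φ y ∉ likelyValues μ φ s δ y}}
      ≤ _ := (measure_mono hsub).trans (measure_biUnion_finset_le _ _)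
    _ ≤ ∑ a ∈ Finset.univ.filter (· ∉ likelyValues μ φ s δ y), δ :=
        Finset.sum_le_sum fun a ha => by
          simpa [mem_likelyValues] using ha
    _ ≤ Fintype.card κ * δ := by
        rw [Finset.sum_const, nsmul_eq_mul]
        gcongr
        exact Finset.card_le_univ _

/-- If the sets of likely values at two adjacent positions coincide and the first value is likely,
then it is likely at the second position too, and the one fresh label reproduces it with probability
above `δ`. The alphabet varies in the induction, which passes from `κ` to `Finset κ`. -/
lemma blockBound_le_measure_eq (m : ℕ) : ∀ {κ : Type} [Fintype κ] [Nonempty κ] {φ : (ℤ → B) → κ},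
    (∀ a, MeasurableSet {y | φ y = a}) → DependsOn φ (Set.Ico 0 (m : ℤ)) →
    blockBound m (Fintype.card κ) ≤ (iidLaw μ).real {y | φ y = φ (translate (-1) y)} := by
  induction m with
  | zero =>
    intro κ _ _ φ _ hdep
    have : {y | φ y = φ (translate (-1) y)} = Set.univ := by
      ext y
      simp only [Set.mem_ofPred_eq, Set.mem_univ, iff_true]
      exact hdep (by simp)
    simp [this, blockBound]
  | succ m ih =>
    intro κ _ _ φ hφ hdep
    set Q := Fintype.card κ with hQ
    have hQ0 : 0 < Q := Fintype.card_pos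
    set e := blockBound m (2 ^ Q) with he
    have he0 : 0 < e := blockBound_pos m (by positivity)
    -- This maximises `δ * (e - Q * δ)`; the maximum `e ^ 2 / (4 * Q)` is the recursion of
    -- `blockBound`.
    set δ : ℝ := e / (2 * Q) with hδ
    have hδ0 : 0 < δ := by positivity
    set s := Set.Ico 0 (m : ℤ)
    set ψ := likelyValues μ φ s (ENNReal.ofReal δ) with hψ
    have hψm := measurableSet_likelyValues μ hφ s (ENNReal.ofReal δ)
    have hσ := (measurePreserving_translate μ (-1)).measurable
    have hψdep : DependsOn ψ s := fun y₁ y₂ h => likelyValues_congr μ h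
    have ihψ := ih hψm hψdep
    rw [Fintype.card_finset, ← hQ, ← he] at ihψ
    have hE : MeasurableSet {y | φ y = φ (translate (-1) y)} :=
      measurableSet_eq_comp hφ fun a => hσ (hφ a)
    set H := {y | ψ y = ψ (translate (-1) y) ∧ φ y ∈ ψ y}
    have hH : e - Q * δ ≤ (iidLaw μ).real H := by
      have h₁ : (iidLaw μ).real {y | φ y ∉ ψ y} ≤ Q * δ := by
        have := measure_notMem_likelyValues_le μ hφ s (ENNReal.ofReal δ)
        refine ENNReal.toReal_le_of_le_ofReal (by positivity) (this.trans_eq ?_)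
        rw [ENNReal.ofReal_mul (by positivity), ENNReal.ofReal_natCast]
      have h₂ : {y | ψ y = ψ (translate (-1) y)} ⊆ H ∪ {y | φ y ∉ ψ y} := by
        intro y hy
        by_cases h : φ y ∈ ψ y
        · exact Or.inl ⟨hy, h⟩
        · exact Or.inr h
      have h₃ := (measureReal_mono (μ := iidLaw μ) h₂).trans (measureReal_union_le _ _)
      linarith
    have hmain : ENNReal.ofReal δ * iidLaw μ H ≤
        iidLaw μ {y | φ y = φ (translate (-1) y)} := by
      set s' := Set.Ico 0 ((m + 1 : ℕ) : ℤ)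
      rw [iidLaw_apply_mix μ s' hE]
      -- Markov's inequality: on `H` the conditional probability of a coincidence given the labels
      -- in `s'` is at least `δ`.
      refine le_trans ?_ (mul_meas_ge_le_lintegral (measurable_measure_mix μ s' hE)
        (ENNReal.ofReal δ))
      gcongr
      intro y hy
      have h₁ : {y' | mix s' y y' ∈ {y | φ y = φ (translate (-1) y)}} =
          translate (-1) ⁻¹' {y' | φ (mix s (translate (-1) y) y') = φ y} := by
        ext y'
        simp only [Set.mem_ofPred_eq, Set.mem_preimage]
        rw [hdep (y := y) fun v hv => mix_of_mem hv, hdep fun v hv => shift_mix m y y' v hv]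
        exact eq_comm
      have h₂ : MeasurableSet {y' | φ (mix s (translate (-1) y) y') = φ y} :=
        ((measurable_mix s).comp measurable_prodMk_left) (hφ (φ y))
      rw [Set.mem_ofPred_eq, h₁, iidLaw_preimage_translate μ _ h₂]
      have h₃ := hy.2
      rw [hy.1] at h₃
      exact ((mem_likelyValues μ).1 h₃).le
    have hreal : δ * (iidLaw μ).real H ≤ (iidLaw μ).real {y | φ y = φ (translate (-1) y)} := by
      have := ENNReal.toReal_mono (measure_ne_top _ _) hmain
      rwa [ENNReal.toReal_mul, ENNReal.toReal_ofReal hδ0.le] at this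
    calc blockBound (m + 1) Q = δ * (e - Q * δ) := by
          rw [blockBound, ← he, hδ]
          have : (Q : ℝ) ≠ 0 := by positivity
          field_simp
          ring
      _ ≤ δ * (iidLaw μ).real H := by gcongr
      _ ≤ _ := hreal

end BlockFactor

/-! ### The coincidence bound is at least an inverse tower -/

section Growth

lemma iterate_exp_mono {x y : ℝ} (h : x ≤ y) (m : ℕ) : Real.exp^[m] x ≤ Real.exp^[m] y :=
  Real.exp_monotone.iterate m h

lemma le_iterate_exp (x : ℝ) (m : ℕ) : x ≤ Real.exp^[m] x :=
  Function.id_le_iterate_of_id_le (fun x => by simpa using by linarith [Real.add_one_le_exp x]) m x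

lemma iterate_exp_le_iterate_exp {m n : ℕ} (h : m ≤ n) (x : ℝ) :
    Real.exp^[m] x ≤ Real.exp^[n] x :=
  Function.monotone_iterate_of_id_le
    (fun x => by show x ≤ _; linarith [Real.add_one_le_exp x]) h x

/-- Products pass under each exponential because `x + z ≤ x * z` for `x, z ≥ 2`. -/
lemma iterate_exp_mul_le (m : ℕ) {x z : ℝ} (hx : 2 ≤ x) (hz : 2 ≤ z) :
    Real.exp^[m] x * Real.exp^[m] z ≤ Real.exp^[m] (x * z) := by
  induction m generalizing x z with
  | zero => simp
  | succ m ih =>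
    simp only [Function.iterate_succ_apply]
    refine (ih (by linarith [Real.add_one_le_exp x]) (by linarith [Real.add_one_le_exp z])).trans
      (iterate_exp_mono ?_ m)
    rw [← Real.exp_add]
    gcongr
    nlinarith

/-- The factor 8 lets one step of the recursion cost one exponential: `4 * Q * (8 * 2 ^ Q) ^ 2 ≤
2048 ^ Q ≤ exp (8 * Q)`. -/
lemma inv_blockBound_le (m : ℕ) {Q : ℕ} (hQ : 0 < Q) :
    (blockBound m Q)⁻¹ ≤ Real.exp^[m] (8 * Q) := by
  induction m generalizing Q with
  | zero =>
    have : (1 : ℝ) ≤ Q := by exact_mod_cast hQ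
    simp only [blockBound, Function.iterate_zero, id]
    linarith
  | succ m ih =>
    have hQ1 : (1 : ℝ) ≤ Q := by exact_mod_cast hQ
    have h2 : (1 : ℝ) ≤ 2 ^ Q := one_le_pow₀ (by norm_num)
    have ihm := ih (Q := 2 ^ Q) (by positivity)
    push_cast at ihm
    have hpos : 0 < blockBound m (2 ^ Q) := blockBound_pos m (by positivity)
    have hx : (2 : ℝ) ≤ 8 * 2 ^ Q := by linarith
    calc (blockBound (m + 1) Q)⁻¹
        = (4 * Q) * ((blockBound m (2 ^ Q))⁻¹ * (blockBound m (2 ^ Q))⁻¹) := by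
          rw [blockBound]
          field_simp
      _ ≤ Real.exp^[m] (4 * Q) *
          (Real.exp^[m] (8 * 2 ^ Q) * Real.exp^[m] (8 * 2 ^ Q)) := by
          have h₁ := le_iterate_exp (4 * Q : ℝ) m
          have h₂ := le_iterate_exp (8 * 2 ^ Q : ℝ) m
          have h₃ : 0 ≤ Real.exp^[m] (4 * Q) := by linarith
          have h₄ : 0 ≤ Real.exp^[m] (8 * 2 ^ Q) := by linarith
          gcongr
      _ ≤ Real.exp^[m] (4 * Q) * Real.exp^[m] (8 * 2 ^ Q * (8 * 2 ^ Q)) := by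
          have := le_iterate_exp (4 * Q : ℝ) m
          exact mul_le_mul_of_nonneg_left (iterate_exp_mul_le m hx hx) (by linarith)
      _ ≤ Real.exp^[m] (4 * Q * (8 * 2 ^ Q * (8 * 2 ^ Q))) :=
          iterate_exp_mul_le m (by linarith) (by nlinarith)
      _ ≤ Real.exp^[m + 1] (8 * Q) := by
          rw [Function.iterate_succ_apply]
          refine iterate_exp_mono ?_ m
          have hQ2 : (Q : ℝ) ≤ 2 ^ Q := by exact_mod_cast Nat.lt_two_pow_self.le
          have h8 : (2048 : ℝ) ≤ Real.exp 8 := by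
            have h := Real.exp_one_gt_d9
            have : Real.exp 8 = Real.exp 1 ^ 8 := by
              rw [← Real.exp_nat_mul]
              norm_num
            rw [this]
            calc (2048 : ℝ) ≤ 2.7182818283 ^ 8 := by norm_num
              _ ≤ _ := by gcongr
          have hexp : Real.exp (8 * Q) = Real.exp 8 ^ Q := by
            rw [← Real.exp_nat_mul, mul_comm]
          calc (4 * Q * (8 * 2 ^ Q * (8 * 2 ^ Q)) : ℝ)
              ≤ 256 * ((2 : ℝ) ^ Q * (2 ^ Q * 2 ^ Q)) := by 
                have h4 : (0 : ℝ) ≤ 2 ^ Q * 2 ^ Q := by positivity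
                linear_combination 256 * mul_le_mul_of_nonneg_right hQ2 h4
            _ = 256 * 8 ^ Q := by
              rw [← mul_pow, ← mul_pow]
              norm_num
            _ ≤ 256 ^ Q * 8 ^ Q := by
              gcongr
              exact le_self_pow₀ (by norm_num) hQ.ne'
            _ = 2048 ^ Q := by
              rw [← mul_pow]
              norm_num
            _ ≤ _ := by
              rw [hexp]
              gcongr

end Growth

/-! ### Coding radius and determination by a ball -/

section CodingRadius

variable {A B : Type*} {F : (ℤ → B) → ℤ → A}

lemma DeterminedBy.mono {y : ℤ → B} {r s : ℕ} (h : DeterminedBy F y r) (hrs : r ≤ s) :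
    DeterminedBy F y s :=
  fun y' hy' => h y' fun v hv => hy' v (hv.trans (by exact_mod_cast hrs))

lemma codingRadius_le_iff {y : ℤ → B} {n : ℕ} : codingRadius F y ≤ n ↔ DeterminedBy F y n := by
  refine ⟨fun h => ?_, fun h => iInf₂_le n h⟩
  by_contra hn
  have : ((n + 1 : ℕ) : ℕ∞) ≤ codingRadius F y := by
    refine le_iInf₂ fun r hr => ?_
    have : ¬ r ≤ n := fun hrn => hn (hr.mono hrn)
    exact_mod_cast (by omega : n + 1 ≤ r)
  have := this.trans h
  norm_cast at this
  omega

lemma ofReal_lt_codingRadius_iff {y : ℤ → B} {r : ℝ} (hr : 0 ≤ r) :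
    ENNReal.ofReal r < ((codingRadius F y : ℕ∞) : ℝ≥0∞) ↔ ¬ DeterminedBy F y ⌊r⌋₊ := by
  rw [← codingRadius_le_iff]
  generalize codingRadius F y = R
  induction R using ENat.recTopCoe with
  | top => simp
  | coe R =>
    rw [ENat.toENNReal_coe, Nat.cast_le, not_le, ← ENNReal.ofReal_natCast,
      ENNReal.ofReal_lt_ofReal_iff_of_nonneg hr, Nat.floor_lt hr]

lemma apply_eq_apply_translate (hF : ∀ (t : ℤ) (y : ℤ → B), F (translate t y) = translate t (F y))
    (y : ℤ → B) (v : ℤ) : F y v = F (translate (-v) y) 0 := by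
  simp [hF, translate]

end CodingRadius

/-! ### Almost sure values, a measurable substitute for `DeterminedBy` -/

section SureValues

variable {B : Type*} [MeasurableSpace B] (μ : Measure B) {q : ℕ}
  (F : (ℤ → B) → ℤ → Fin q)

/-- The values of `F` at the origin that are almost sure given the configuration in the ball of
radius `n`. -/
noncomputable def sureValues (n : ℕ) (y : ℤ → B) : Finset (Fin q) :=
  open Classical in
  Finset.univ.filter fun a => iidLaw μ {y' | F (mix (Set.Icc (-n : ℤ) n) y y') 0 ≠ a} = 0

variable {μ F}

lemma mem_sureValues {n : ℕ} {y : ℤ → B} {a : Fin q} :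
    a ∈ sureValues μ F n y ↔ iidLaw μ {y' | F (mix (Set.Icc (-n : ℤ) n) y y') 0 ≠ a} = 0 := by
  simp [sureValues]

lemma sureValues_congr {n : ℕ} {y₁ y₂ : ℤ → B} (h : ∀ v ∈ Set.Icc (-n : ℤ) n, y₁ v = y₂ v) :
    sureValues μ F n y₁ = sureValues μ F n y₂ := by
  ext a
  simp only [mem_sureValues, mix_congr h]

lemma mem_sureValues_of_determinedBy {n : ℕ} {y : ℤ → B} (h : DeterminedBy F y n) :
    F y 0 ∈ sureValues μ F n y := by
  rw [mem_sureValues]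
  have : {y' | F (mix (Set.Icc (-n : ℤ) n) y y') 0 ≠ F y 0} = ∅ := by
    ext y'
    simp only [Set.mem_ofPred_eq, Set.mem_empty_iff_false, iff_false, not_not]
    exact h _ fun v hv => mix_of_mem (abs_le.1 hv)
  simp [this]

variable [IsProbabilityMeasure μ] (hF : Measurable F)

include hF

lemma measurableSet_apply_ne (a : Fin q) : MeasurableSet {y | F y 0 ≠ a} :=
  ((measurable_pi_apply 0).comp hF) (MeasurableSet.of_discrete (s := {b | b ≠ a}))

lemma measurableSet_mem_sureValues (n : ℕ) (a : Fin q) :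
    MeasurableSet {y | a ∈ sureValues μ F n y} := by
  simp only [mem_sureValues]
  exact measurable_measure_mix μ _ (measurableSet_apply_ne hF a) (measurableSet_singleton 0)

lemma measurableSet_sureValues_eq (n : ℕ) (s : Finset (Fin q)) :
    MeasurableSet {y | sureValues μ F n y = s} := by
  have : {y | sureValues μ F n y = s} = ⋂ a, {y | a ∈ sureValues μ F n y ↔ a ∈ s} := by
    ext y
    simp [Finset.ext_iff]
  rw [this]
  refine MeasurableSet.iInter fun a => ?_
  have hm := measurableSet_mem_sureValues hF (μ := μ) n a
  by_cases ha : a ∈ s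
  · simpa only [ha, iff_true] using hm
  · simp only [ha, iff_false]
    exact hm.compl

lemma ae_eq_of_mem_sureValues (n : ℕ) :
    ∀ᵐ y ∂iidLaw μ, ∀ a ∈ sureValues μ F n y, F y 0 = a := by
  rw [ae_all_iff]
  intro a
  rw [ae_iff]
  have hE : MeasurableSet {y | ¬ (a ∈ sureValues μ F n y → F y 0 = a)} := by
    have : {y | ¬ (a ∈ sureValues μ F n y → F y 0 = a)} =
        {y | a ∈ sureValues μ F n y} ∩ {y | F y 0 ≠ a} := by
      ext y
      simp
    rw [this]
    exact (measurableSet_mem_sureValues hF n a).inter (measurableSet_apply_ne hF a)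
  rw [iidLaw_apply_mix μ (Set.Icc (-n : ℤ) n) hE]
  refine (lintegral_congr fun y => ?_).trans lintegral_zero
  by_cases ha : a ∈ sureValues μ F n y
  · refine measure_mono_null (fun y' hy' => ?_) (mem_sureValues.1 ha)
    simp only [Set.mem_ofPred_eq, Classical.not_imp] at hy'
    exact hy'.2
  · convert measure_empty (μ := iidLaw μ)
    ext y'
    simp only [Set.mem_ofPred_eq, Classical.not_imp, Set.mem_empty_iff_false, iff_false, not_and]
    intro h
    rw [sureValues_congr (y₂ := y) fun v hv => mix_of_mem hv] at h
    exact absurd h ha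

lemma ae_forall_eq_of_mem_sureValues
    (hequi : ∀ (t : ℤ) (y : ℤ → B), F (translate t y) = translate t (F y)) (n : ℕ) :
    ∀ᵐ y ∂iidLaw μ, ∀ v : ℤ, ∀ a ∈ sureValues μ F n (translate (-v) y), F y v = a := by
  rw [ae_all_iff]
  intro v
  simp only [apply_eq_apply_translate hequi _ v]
  exact (measurePreserving_translate μ (-v)).quasiMeasurePreserving.ae
    (ae_eq_of_mem_sureValues hF n)

end SureValues

/-! ### Lower bound on the tail -/

section LowerBound

variable {B : Type*} [MeasurableSpace B] {μ : Measure B} [IsProbabilityMeasure μ] {q k : ℕ}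
  {W : Set (Fin k → Fin q)} {F : (ℤ → B) → ℤ → Fin q}

lemma const_mem_sft {x : ℤ → Fin q} (hx : x ∈ sft q k W) {a : Fin q} {i : ℤ}
    (h : ∀ j : Fin k, x (i + 1 + (j : ℕ)) = a) : (fun _ : ℤ => a) ∈ sft q k W := by
  intro i'
  have : pattern k (fun _ : ℤ => a) i' = pattern k x i := by
    ext1 j
    exact (h j).symm
  rw [this]
  exact hx i

variable (hF : Measurable F)
  (hequi : ∀ (t : ℤ) (y : ℤ → B), F (translate t y) = translate t (F y))
  (hsft : ∀ᵐ y ∂iidLaw μ, F y ∈ sft q k W)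
  (hW : ∀ a : Fin q, (fun _ : ℤ => a) ∉ sft q k W)

include hF hequi hsft hW

lemma blockBound_le_measure_not_determinedBy (n : ℕ) :
    blockBound (2 * n + 1 + k) (Fintype.card (Fin (k + 1) → Finset (Fin q))) ≤
      (iidLaw μ).real {y | ¬ DeterminedBy F y n} := by
  -- The sites `n, …, n + k` are those whose balls of radius `n` fill the block `[0, 2 * n + 1 +
  -- k)`.
  set φ : (ℤ → B) → Fin (k + 1) → Finset (Fin q) :=
    fun y j => sureValues μ F n (translate (-(n + (j : ℕ))) y) with hφ
  have hφm : ∀ a, MeasurableSet {y | φ y = a} := by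
    intro a
    have : {y | φ y = a} =
        ⋂ j : Fin (k + 1), translate (-(n + (j : ℕ))) ⁻¹' {y | sureValues μ F n y = a j} := by
      ext y
      simp [hφ, funext_iff]
    rw [this]
    exact MeasurableSet.iInter fun j =>
      (measurePreserving_translate μ _).measurable (measurableSet_sureValues_eq hF n _)
  have hφdep : DependsOn φ (Set.Ico 0 ((2 * n + 1 + k : ℕ) : ℤ)) := by
    intro y₁ y₂ h
    ext1 j
    refine sureValues_congr fun v hv => h _ ?_
    have := j.2
    simp only [Set.mem_Icc, Set.mem_Ico] at hv ⊢
    push_cast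
    omega
  refine (blockBound_le_measure_eq μ _ hφm hφdep).trans ?_
  have hae : ∀ᵐ y ∂iidLaw μ, φ y = φ (translate (-1) y) →
      sureValues μ F n (translate (-(n : ℤ)) y) = ∅ := by
    filter_upwards [hsft, ae_forall_eq_of_mem_sureValues hF hequi n (μ := μ)] with y hy hv heq
    by_contra hne
    obtain ⟨a, ha⟩ := Finset.nonempty_iff_ne_empty.2 hne
    have hall : ∀ j : ℕ, j ≤ k + 1 → a ∈ sureValues μ F n (translate (-(n + (j : ℕ) : ℤ)) y) := by
      intro j
      induction j with
      | zero => simpa using ha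
      | succ j ih =>
        intro hj
        have h₁ := congrFun heq ⟨j, by omega⟩
        simp only [hφ, translate_translate] at h₁
        have h₂ := ih (by omega)
        rw [h₁] at h₂
        convert h₂ using 3
        push_cast
        ring
    refine hW a (const_mem_sft hy (i := n) fun j => hv _ a ?_)
    convert hall (j + 1) (by omega) using 3
    push_cast
    ring
  have h₁ : (iidLaw μ).real {y | φ y = φ (translate (-1) y)} ≤
      (iidLaw μ).real (translate (-(n : ℤ)) ⁻¹' {y | sureValues μ F n y = ∅}) :=
    ENNReal.toReal_mono (measure_ne_top _ _) (measure_mono_ae hae)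
  refine h₁.trans ?_
  rw [measureReal_def, iidLaw_preimage_translate μ _ (measurableSet_sureValues_eq hF n ∅)]
  refine measureReal_mono fun y hy h => ?_
  have := mem_sureValues_of_determinedBy (μ := μ) h
  rw [hy] at this
  simp at this

/-- For small `r` the tower equals 1, so the tail must be exactly 1. If a single label forced a
symbol with positive probability, then by independence `k` consecutive labels would force a constant
pattern. -/
lemma measure_not_determinedBy_zero :
    (iidLaw μ).real {y | ¬ DeterminedBy F y 0} = 1 := by
  by_contra hne
  have hlt : (iidLaw μ).real {y | ¬ DeterminedBy F y 0} < 1 :=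
    lt_of_le_of_ne measureReal_le_one hne
  have hpos : ∃ a, iidLaw μ {y | a ∈ sureValues μ F 0 y} ≠ 0 := by
    by_contra! hzero
    refine hlt.not_ge ?_
    have hempty : ∀ᵐ y ∂iidLaw μ, y ∈ {y | ¬ DeterminedBy F y 0} := by
      have : ∀ᵐ y ∂iidLaw μ, ∀ a, a ∉ sureValues μ F 0 y := by
        rw [ae_all_iff]
        intro a
        rw [ae_iff]
        simpa using hzero a
      filter_upwards [this] with y hy h
      exact hy _ (mem_sureValues_of_determinedBy h)
    have : iidLaw μ {y | ¬ DeterminedBy F y 0} = 1 := by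
      rw [← measure_univ (μ := iidLaw μ)]
      exact le_antisymm (measure_mono (Set.subset_univ _))
        (measure_mono_ae (hempty.mono fun y hy _ => hy))
    rw [measureReal_def, this]
    simp
  obtain ⟨a, ha⟩ := hpos
  -- At radius 0 only the label at the origin matters, so constant configurations serve as test
  -- points.
  set D : Set B := {b | a ∈ sureValues μ F 0 fun _ : ℤ => b} with hD
  have hDm : MeasurableSet D :=
    (measurable_pi_lambda (fun (b : B) (_ : ℤ) => b) fun _ => measurable_id)
      (measurableSet_mem_sureValues hF 0 a)
  have hmem : ∀ y : ℤ → B, y 0 ∈ D ↔ a ∈ sureValues μ F 0 y := by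
    intro y
    rw [hD, Set.mem_ofPred_eq, sureValues_congr (y₂ := y)]
    intro v hv
    simp only [CharP.cast_eq_zero, neg_zero, Set.Icc_self, Set.mem_singleton_iff] at hv
    rw [hv]
  have hμD : μ D ≠ 0 := by
    rw [← (measurePreserving_eval_infinitePi (fun _ : ℤ => μ) 0).measure_preimage
      hDm.nullMeasurableSet]
    convert ha using 2
    ext y
    exact hmem y
  have hbox : iidLaw μ (Set.pi (Finset.Icc (1 : ℤ) k) fun _ => D) ≠ 0 := by
    rw [Measure.infinitePi_pi _ fun _ _ => hDm]
    exact Finset.prod_ne_zero_iff.2 fun _ _ => hμD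
  have hae : ∀ᵐ y ∂iidLaw μ, y ∉ Set.pi (Finset.Icc (1 : ℤ) k) fun _ => D := by
    filter_upwards [hsft, ae_forall_eq_of_mem_sureValues hF hequi 0 (μ := μ)] with y hy hv hbox
    refine hW a (const_mem_sft hy (i := 0) fun j => hv _ a ?_)
    rw [← hmem]
    have := hbox (0 + 1 + (j : ℕ)) (by
      have := j.2
      simp only [Finset.coe_Icc, Set.mem_Icc]
      omega)
    simpa [translate] using this
  rw [ae_iff] at hae
  simp only [not_not] at hae
  exact hbox hae

end LowerBound

lemma measurableSet_sft (q k : ℕ) (W : Set (Fin k → Fin q)) : MeasurableSet (sft q k W) := by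
  have : sft q k W = ⋂ i : ℤ, (fun x => pattern k x i) ⁻¹' W := by
    ext x
    simp [sft]
  rw [this]
  exact MeasurableSet.iInter fun i =>
    (measurable_pi_lambda _ fun j => measurable_pi_apply _) MeasurableSet.of_discrete

theorem exists_tower_le_tail (q k : ℕ) (W : Set (Fin k → Fin q))
    (hW : ∀ a : Fin q, (fun _ : ℤ => a) ∉ sft q k W) :
    ∃ C : ℝ, 0 < C ∧
      ∀ (Ω : Type*) [MeasurableSpace Ω] (B : Type*) [MeasurableSpace B]
        (P : Measure Ω) (X : Ω → ℤ → Fin q) (Y : ℤ → Ω → B) (F : (ℤ → B) → ℤ → Fin q),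
        IsFFIID P X Y F → (∀ᵐ ω ∂P, X ω ∈ sft q k W) →
        ∀ r : ℝ, 0 < r → 1 / tower (C * r) ≤ tail P Y F r := by
  set Q := Fintype.card (Fin (k + 1) → Finset (Fin q))
  have hQ : 0 < Q := Fintype.card_pos
  obtain ⟨m₀, hm₀⟩ : ∃ m₀ : ℕ, (8 * Q : ℝ) ≤ Real.exp^[m₀] 1 := by
    have hle : ∀ m : ℕ, (m + 1 : ℝ) ≤ Real.exp^[m] 1 := by
      intro m
      induction m with
      | zero => simp
      | succ m ih =>
        rw [Function.iterate_succ_apply']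
        have := Real.add_one_le_exp (Real.exp^[m] 1)
        push_cast
        linarith
    exact ⟨8 * Q, by have := hle (8 * Q); push_cast at this; linarith⟩
  -- For `r ≥ 1` and `n = ⌊r⌋₊`, the number of exponentials `2 * n + 1 + k + m₀` is at most `(3 + k
  -- + m₀) * r`.
  refine ⟨3 + k + m₀, by positivity, ?_⟩
  intro Ω _ B _ P X Y F h hX r hr
  have := h.isProbabilityMeasure
  set μ := P.map (Y 0) with hμ
  have hμp : IsProbabilityMeasure μ := Measure.isProbabilityMeasure_map (h.measurable 0).aemeasurable
  have hlaw : law P Y = iidLaw μ := by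
    rw [law, h.indep.map_fun_eq_infinitePi_map h.measurable]
    congr 1
    ext1 v
    exact (h.identDistrib v 0).map_eq
  have hsft : ∀ᵐ y ∂iidLaw μ, F y ∈ sft q k W := by
    rw [← hlaw, law, ae_map_iff (measurable_pi_lambda _ h.measurable).aemeasurable
      (h.measurable_map (measurableSet_sft q k W))]
    filter_upwards [hX] with ω hω
    rwa [← h.eq_map]
  have htail : tail P Y F r = (iidLaw μ).real {y | ¬ DeterminedBy F y ⌊r⌋₊} := by
    rw [tail, hlaw]
    congr 1
    ext y
    exact ofReal_lt_codingRadius_iff hr.le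
  rw [htail, tower]
  rcases lt_or_ge r 1 with hr1 | hr1
  · rw [Nat.floor_eq_zero.2 hr1,
      measure_not_determinedBy_zero h.measurable_map h.equivariant hsft hW]
    have := le_iterate_exp 1 ⌊(3 + k + m₀) * r⌋₊
    exact div_le_one_of_le₀ this (by linarith)
  · set n := ⌊r⌋₊
    refine le_trans ?_ (blockBound_le_measure_not_determinedBy h.measurable_map h.equivariant
      hsft hW n)
    rw [one_div]
    refine inv_le_of_inv_le₀ (blockBound_pos _ hQ) ((inv_blockBound_le _ hQ).trans ?_)
    refine (iterate_exp_mono hm₀ _).trans ?_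
    rw [← Function.iterate_add_apply]
    refine iterate_exp_le_iterate_exp (Nat.le_floor ?_) 1
    have hn : (n : ℝ) ≤ r := Nat.floor_le hr.le
    push_cast
    nlinarith [mul_nonneg (Nat.cast_nonneg (α := ℝ) k) (by linarith : (0 : ℝ) ≤ r - 1),
      mul_nonneg (Nat.cast_nonneg (α := ℝ) m₀) (by linarith : (0 : ℝ) ≤ r - 1)]

/-! ### Cole–Vishkin colour reduction and ranks -/

section ColourReduction

/-- One step of Cole–Vishkin colour reduction: the first binary digit of `a` at which `a` and `b`
differ, together with its position. -/
noncomputable def reduceColour (a b : ℕ) : ℕ :=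
  2 * sInf {i | a.testBit i ≠ b.testBit i} +
    (a.testBit (sInf {i | a.testBit i ≠ b.testBit i})).toNat

lemma testBit_sInf_ne {a b : ℕ} (h : a ≠ b) :
    a.testBit (sInf {i | a.testBit i ≠ b.testBit i}) ≠
      b.testBit (sInf {i | a.testBit i ≠ b.testBit i}) :=
  Nat.sInf_mem (s := {i | a.testBit i ≠ b.testBit i}) (Nat.exists_testBit_ne_of_ne h)

/-- Equal results would give the same position and the same bit there, but `a` and `b` differ at the
position chosen for `a`. As `c` is arbitrary, what `b` is compared with is irrelevant. -/
lemma reduceColour_ne {a b c : ℕ} (hab : a ≠ b) : reduceColour a b ≠ reduceColour b c := by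
  have h := testBit_sInf_ne hab
  intro heq
  rw [reduceColour, reduceColour] at heq
  generalize sInf {i | a.testBit i ≠ b.testBit i} = d at *
  generalize sInf {i | b.testBit i ≠ c.testBit i} = d' at *
  have h₁ := Bool.toNat_le (a.testBit d)
  have h₂ := Bool.toNat_le (b.testBit d')
  obtain rfl : d = d' := by omega
  have h₃ : (a.testBit d).toNat = (b.testBit d).toNat := by omega
  revert h₃ h
  cases a.testBit d <;> cases b.testBit d <;> simp

lemma reduceColour_lt {a b m : ℕ} (hab : a ≠ b) (ha : a < 2 ^ m) (hb : b < 2 ^ m) :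
    reduceColour a b < 2 * m := by
  have h := testBit_sInf_ne hab
  rw [reduceColour]
  generalize sInf {i | a.testBit i ≠ b.testBit i} = d at *
  have hd : d < m := by
    by_contra! hmd
    have hpow := Nat.pow_le_pow_right (n := 2) (by norm_num) hmd
    exact h ((Nat.testBit_lt_two_pow (ha.trans_le hpow)).trans
      (Nat.testBit_lt_two_pow (hb.trans_le hpow)).symm)
  have h₁ := Bool.toNat_le (a.testBit d)
  omega

/-- The number of colours that `j` steps of colour reduction bring down to `8`. -/
def paletteSize : ℕ → ℕ
  | 0 => 8
  | j + 1 => 2 ^ (paletteSize j / 2)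

lemma eight_le_paletteSize (j : ℕ) : 8 ≤ paletteSize j := by
  induction j with
  | zero => exact le_rfl
  | succ j ih =>
    calc 8 = 2 ^ 3 := by norm_num
      _ ≤ 2 ^ (paletteSize j / 2) := Nat.pow_le_pow_right (by norm_num) (by omega)

/-- The configurations `z` and `z'` look the same from `i` and from `i'`, up to distance `ρ`. -/
def Agree {A : Type*} (z z' : ℤ → A) (i i' : ℤ) (ρ : ℕ) : Prop :=
  ∀ d : ℤ, |d| ≤ ρ → z (i + d) = z' (i' + d)

namespace Agree

variable {A : Type*} {z z' : ℤ → A} {i i' : ℤ} {ρ σ : ℕ}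

lemma mono (h : Agree z z' i i' ρ) (hσ : σ ≤ ρ) : Agree z z' i i' σ :=
  fun d hd => h d (hd.trans (by exact_mod_cast hσ))

lemma symm (h : Agree z z' i i' ρ) : Agree z' z i' i ρ := fun d hd => (h d hd).symm

lemma eq (h : Agree z z' i i' ρ) : z i = z' i' := by simpa using h 0 (by simp)

lemma shift (h : Agree z z' i i' ρ) {e : ℤ} (he : |e| + σ ≤ ρ) :
    Agree z z' (i + e) (i' + e) σ := by
  intro d hd
  rw [add_assoc, add_assoc]
  exact h _ ((abs_add_le _ _).trans (by linarith))

end Agree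

/-- The colours of the configuration `z` of levels and colours after `t` steps of colour reduction,
where the vertex `i` compares its colour with the one of the vertex `i + s` if the latter has the
same level. -/
noncomputable def reducedColour (s : ℕ) (z : ℤ → ℕ × ℕ) : ℕ → ℤ → ℕ
  | 0, i => (z i).2
  | t + 1, i =>
    reduceColour (reducedColour s z t i)
      (if (z (i + s)).1 = (z i).1 then reducedColour s z t (i + s)
        else if reducedColour s z t i = 0 then 1 else 0)

/-- The colours are within the palettes of their levels, and two vertices at distance less than `N`
with the same level have different colours. -/
structure ProperlyColoured (N : ℕ) (z : ℤ → ℕ × ℕ) : Prop where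
  lt : ∀ i, (z i).2 < paletteSize (z i).1
  ne : ∀ (i : ℤ) (d : ℕ), 0 < d → d < N → z i ≠ z (i + d)

variable {N : ℕ} {z z' : ℤ → ℕ × ℕ}

lemma ProperlyColoured.reducedColour_ne (hz : ProperlyColoured N z) {s : ℕ} (hs : 0 < s)
    (hsN : s < N) (t : ℕ) (i : ℤ) (h : (z (i + s)).1 = (z i).1) :
    reducedColour s z t i ≠ reducedColour s z t (i + s) := by
  induction t generalizing i with
  | zero =>
    intro h'
    exact hz.ne i s hs hsN (Prod.ext h.symm h')
  | succ t ih =>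
    rw [reducedColour, reducedColour, if_pos h]
    exact reduceColour_ne (ih i h)

/-- Each step sends colours below `2 ^ (p / 2)` to colours below `p`, hence down one palette. The
substitutes 0 and 1, used when the other site has another level, fit in every palette. -/
lemma ProperlyColoured.reducedColour_lt (hz : ProperlyColoured N z) {s : ℕ} (hs : 0 < s)
    (hsN : s < N) (t : ℕ) (i : ℤ) (h : t ≤ (z i).1) :
    reducedColour s z t i < paletteSize ((z i).1 - t) := by
  induction t generalizing i with
  | zero => exact hz.lt i
  | succ t ih =>
    obtain ⟨m, hm⟩ : ∃ m, (z i).1 - t = m + 1 := ⟨(z i).1 - t - 1, by omega⟩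
    have hm' : (z i).1 - (t + 1) = m := by omega
    have h8 := eight_le_paletteSize m
    have hpow : 8 ≤ 2 ^ (paletteSize m / 2) := eight_le_paletteSize (m + 1)
    have hi := ih i (by omega)
    rw [hm, paletteSize] at hi
    rw [hm', reducedColour]
    refine lt_of_lt_of_le (reduceColour_lt (m := paletteSize m / 2) ?_ hi ?_) (by omega)
    · split_ifs with h₁ h₂
      · exact hz.reducedColour_ne hs hsN t i h₁
      · omega
      · omega
    · split_ifs with h₁ h₂
      · have hi' := ih (i + s) (by omega)
        rwa [h₁, hm, paletteSize] at hi'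
      · omega
      · omega

lemma reducedColour_congr {s : ℕ} (t : ℕ) {i i' : ℤ} (h : Agree z z' i i' (s * t)) :
    reducedColour s z t i = reducedColour s z' t i' := by
  induction t generalizing i i' with
  | zero => simp only [reducedColour, h.eq]
  | succ t ih =>
    have h₁ := ih (h.mono (by rw [mul_add]; omega))
    have h₃ : Agree z z' (i + s) (i' + s) (s * t) := h.shift (by
      rw [Nat.abs_cast]
      push_cast
      linarith)
    rw [reducedColour, reducedColour, h₁, ih h₃, h.eq, h₃.eq]

/-- The level of a vertex together with its colours after the reductions, as a natural number. -/
noncomputable def rank (N : ℕ) (z : ℤ → ℕ × ℕ) (i : ℤ) : ℕ :=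
  (z i).1 * 8 ^ N + (finFunctionFinEquiv fun s : Fin N =>
    (⟨reducedColour s z (z i).1 i % 8, Nat.mod_lt _ (by norm_num)⟩ : Fin 8) : Fin (8 ^ N))

lemma level_le_rank (i : ℤ) : (z i).1 ≤ rank N z i :=
  (Nat.le_mul_of_pos_right _ (by positivity)).trans (Nat.le_add_right _ _)

lemma rank_lt (i : ℤ) : rank N z i < ((z i).1 + 1) * 8 ^ N := by
  rw [rank, add_one_mul]
  exact Nat.add_lt_add_left (Fin.is_lt _) _

/-- Equal ranks give equal levels and equal digits; the digit for step size `d` already separates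
the two sites. The remainder modulo 8 is harmless there, since that colour is below 8. -/
lemma ProperlyColoured.rank_ne (hz : ProperlyColoured N z) {d : ℕ} (hd : 0 < d) (hdN : d < N)
    (i : ℤ) : rank N z i ≠ rank N z (i + d) := by
  intro h
  rw [rank, rank] at h
  have hpos : 0 < 8 ^ N := by positivity
  have h₁ := congrArg (· / 8 ^ N) h
  have h₂ := congrArg (· % 8 ^ N) h
  simp only [mul_comm _ (8 ^ N), Nat.mul_add_div hpos, Nat.mul_add_mod,
    Nat.div_eq_of_lt (Fin.is_lt _), Nat.mod_eq_of_lt (Fin.is_lt _), add_zero] at h₁ h₂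
  have h₃ := congrFun (finFunctionFinEquiv.injective (Fin.ext h₂)) ⟨d, hdN⟩
  simp only [Fin.mk.injEq] at h₃
  have h₄ := hz.reducedColour_lt hd hdN (z i).1 i le_rfl
  have h₅ := hz.reducedColour_lt hd hdN (z (i + d)).1 (i + d) le_rfl
  rw [Nat.sub_self, paletteSize] at h₄ h₅
  rw [Nat.mod_eq_of_lt h₄, Nat.mod_eq_of_lt h₅, ← h₁] at h₃
  exact hz.reducedColour_ne hd hdN _ i h₁.symm h₃

lemma rank_congr {i i' : ℤ} (h : Agree z z' i i' (N * (z i).1)) :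
    rank N z i = rank N z' i' := by
  have hs : ∀ s : Fin N, reducedColour s z (z i).1 i = reducedColour s z' (z' i').1 i' := by
    intro s
    rw [reducedColour_congr _ (h.mono (Nat.mul_le_mul_right _ s.2.le)), h.eq]
  simp only [rank, hs]
  exact congrArg (· * 8 ^ N + _) (congrArg Prod.fst h.eq)

/-- The level is at most the rank, so whether the rank is `n` is decided within distance `N * n`,
whatever the actual level. -/
lemma rank_eq_iff_of_agree {i i' : ℤ} {n : ℕ} (h : Agree z z' i i' (N * n)) :
    rank N z i = n ↔ rank N z' i' = n := by
  constructor
  · rintro rfl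
    exact (rank_congr (h.mono (Nat.mul_le_mul_left _ (level_le_rank i)))).symm
  · rintro rfl
    exact (rank_congr (h.symm.mono (Nat.mul_le_mul_left _ (level_le_rank i')))).symm

end ColourReduction

/-! ### Greedy choice of a maximal separated set -/

section GreedySelection

/-- The vertices selected, in order of increasing rank, at distance at least `N` from each other,
among those of rank less than `n`. -/
def stage (N : ℕ) (z : ℤ → ℕ × ℕ) : ℕ → ℤ → Prop
  | 0, _ => False
  | n + 1, i => stage N z n i ∨ rank N z i = n ∧ ∀ d : ℤ, |d| < N → ¬ stage N z n (i + d)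

/-- The vertices selected greedily in order of increasing rank. -/
def Selected (N : ℕ) (z : ℤ → ℕ × ℕ) (i : ℤ) : Prop := stage N z (rank N z i + 1) i

variable {N : ℕ} {z z' : ℤ → ℕ × ℕ}

/-- Each stage consults sites at distance less than `N` about the previous one, so the dependence
radius grows by `N` per stage. -/
lemma stage_congr (n : ℕ) {i i' : ℤ} (h : Agree z z' i i' (N * n)) :
    stage N z n i ↔ stage N z' n i' := by
  induction n generalizing i i' with
  | zero => exact Iff.rfl
  | succ n ih =>
    have hn : Agree z z' i i' (N * n) := h.mono (Nat.mul_le_mul_left _ n.le_succ)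
    rw [stage, stage, ih hn, rank_eq_iff_of_agree hn]
    refine or_congr_right (and_congr_right fun _ => forall₂_congr fun d hd => not_congr (ih ?_))
    refine h.shift ?_
    push_cast
    linarith

lemma selected_congr {i i' : ℤ} (h : Agree z z' i i' (N * (rank N z i + 1))) :
    Selected N z i ↔ Selected N z' i' := by
  have hr : rank N z i = rank N z' i' :=
    rank_congr (h.mono (Nat.mul_le_mul_left _ ((level_le_rank i).trans (Nat.le_succ _))))
  rw [Selected, Selected, ← hr, stage_congr _ h]

lemma stage_mono {m n : ℕ} (h : m ≤ n) {i : ℤ} (hi : stage N z m i) : stage N z n i := by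
  induction n, h using Nat.le_induction with
  | base => exact hi
  | succ n _ ih => exact Or.inl ih

lemma rank_lt_of_stage {n : ℕ} {i : ℤ} (h : stage N z n i) : rank N z i < n := by
  induction n with
  | zero => exact h.elim
  | succ n ih =>
    rcases h with h | h
    · exact (ih h).trans n.lt_succ_self
    · omega

lemma selected_of_stage {n : ℕ} {i : ℤ} (h : stage N z n i) : Selected N z i := by
  induction n with
  | zero => exact h.elim
  | succ n ih =>
    rcases h with h | h
    · exact ih h
    · rw [Selected, h.1]
      exact Or.inr h

lemma Selected.not_selected_of_rank_lt {i : ℤ} (hi : Selected N z i) {d : ℤ} (hd : |d| < N)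
    (hr : rank N z (i + d) < rank N z i) : ¬ Selected N z (i + d) := by
  rcases hi with hi | hi
  · exact absurd (rank_lt_of_stage hi) (lt_irrefl _)
  · exact fun h => hi.2 d hd (stage_mono hr h)

lemma ProperlyColoured.not_selected_add (hz : ProperlyColoured N z) {i : ℤ}
    (hi : Selected N z i) {d : ℕ} (hd : 0 < d) (hdN : d < N) : ¬ Selected N z (i + d) := by
  intro h
  have hdN' : |(d : ℤ)| < N := by
    rw [Nat.abs_cast]
    exact_mod_cast hdN
  rcases lt_or_gt_of_ne (hz.rank_ne hd hdN i) with hlt | hlt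
  · have := h.not_selected_of_rank_lt (d := -d) (by rwa [abs_neg]) (by simpa using hlt)
    simp only [add_neg_cancel_right] at this
    exact this hi
  · exact hi.not_selected_of_rank_lt hdN' hlt h

/-- Maximality of the greedy choice: a site not blocked by an earlier one is itself selected. No
properness of the colouring is needed. -/
lemma exists_selected_near (hN : 0 < N) (i : ℤ) : ∃ d : ℤ, |d| < N ∧ Selected N z (i + d) := by
  by_cases h : ∃ d : ℤ, |d| < N ∧ stage N z (rank N z i) (i + d)
  · obtain ⟨d, hd, h⟩ := h
    exact ⟨d, hd, selected_of_stage h⟩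
  · push Not at h
    exact ⟨0, by simpa using hN, by rw [add_zero]; exact Or.inr ⟨rfl, h⟩⟩

end GreedySelection

/-! ### Filling the gaps with loops -/

section Filling

variable {A : Type*} (N : ℕ) (loop : ℕ → ℤ → A) (J J' : ℤ → Prop)

/-- The distance from `v` to the last point of `J` before it, if it is at most `2 * N`. -/
noncomputable def backGap (v : ℤ) : ℕ := sInf {a : ℕ | 1 ≤ a ∧ a ≤ 2 * N ∧ J (v - a)}

/-- The distance from `v` to the first point of `J` from it on, if it is at most `2 * N`. -/
noncomputable def forwardGap (v : ℤ) : ℕ := sInf {b : ℕ | b ≤ 2 * N ∧ J (v + b)}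

/-- The configuration that traverses `loop t` between any two successive points of `J` at
distance `t`. -/
noncomputable def fill (v : ℤ) : A :=
  loop (backGap N J v + forwardGap N J v) (backGap N J v)

variable {N loop J J'}

lemma fill_congr {v v' : ℤ} (h : ∀ e : ℤ, |e| ≤ (2 * N : ℕ) → (J (v + e) ↔ J' (v' + e))) :
    fill N loop J v = fill N loop J' v' := by
  have h₁ : backGap N J v = backGap N J' v' := by
    rw [backGap, backGap]
    congr 1
    ext a
    simp only [Set.mem_ofPred_eq]
    refine and_congr_right fun _ => and_congr_right fun ha => ?_
    simpa only [sub_eq_add_neg] using h (-a) (by rw [abs_neg, Nat.abs_cast]; exact_mod_cast ha)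
  have h₂ : forwardGap N J v = forwardGap N J' v' := by
    rw [forwardGap, forwardGap]
    congr 1
    ext a
    simp only [Set.mem_ofPred_eq]
    exact and_congr_right fun ha => h a (by rw [Nat.abs_cast]; exact_mod_cast ha)
  rw [fill, fill, h₁, h₂]

lemma fill_eq_loop {p n v : ℤ} {t : ℕ} (hp : J p) (hn : J n) (hno : ∀ m, p < m → m < n → ¬ J m)
    (hpn : n = p + t) (ht : t ≤ 2 * N) (hpv : p < v) (hvn : v ≤ n) :
    fill N loop J v = loop t (v - p) := by
  have h₁ : backGap N J v = (v - p).toNat := by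
    refine IsLeast.csInf_eq ⟨⟨by omega, by omega, ?_⟩, ?_⟩
    · convert hp
      omega
    · rintro a ⟨ha₁, -, ha⟩
      by_contra! hlt
      exact hno _ (by omega) (by omega) ha
  have h₂ : forwardGap N J v = (n - v).toNat := by
    refine IsLeast.csInf_eq ⟨⟨by omega, ?_⟩, ?_⟩
    · convert hn
      omega
    · rintro b ⟨-, hb⟩
      by_contra! hlt
      exact hno _ (by omega) (by omega) hb
  rw [fill, h₁, h₂]
  congr 1
  · omega
  · omega

lemma exists_next (hnear : ∀ i : ℤ, ∃ d : ℤ, |d| < N ∧ J (i + d))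
    (hsep : ∀ (i : ℤ) (d : ℕ), J i → 0 < d → d < N → ¬ J (i + d)) {p : ℤ} (hp : J p) :
    ∃ t : ℕ, N ≤ t ∧ t ≤ 2 * N ∧ J (p + t) ∧ ∀ m, p < m → m < p + t → ¬ J m := by
  classical
  have hex : ∃ t : ℕ, 0 < t ∧ t ≤ 2 * N ∧ J (p + t) := by
    obtain ⟨d, hd, h⟩ := hnear (p + N)
    rw [abs_lt] at hd
    refine ⟨(N + d).toNat, by omega, by omega, ?_⟩
    convert h using 1
    omega
  obtain ⟨h₁, h₂, h₃⟩ := Nat.find_spec hex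
  refine ⟨Nat.find hex, ?_, h₂, h₃, ?_⟩
  · by_contra! hlt
    exact hsep p _ hp h₁ hlt h₃
  · intro m hpm hm hJ
    refine Nat.find_min hex (m := (m - p).toNat) (by omega) ⟨by omega, by omega, ?_⟩
    convert hJ
    omega

lemma exists_last (hnear : ∀ i : ℤ, ∃ d : ℤ, |d| < N ∧ J (i + d)) (i : ℤ) :
    ∃ p ≤ i, J p ∧ ∀ m, p < m → m ≤ i → ¬ J m := by
  classical
  have hex : ∃ a : ℕ, J (i - a) := by
    obtain ⟨d, hd, h⟩ := hnear (i - N)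
    rw [abs_lt] at hd
    refine ⟨(N - d).toNat, ?_⟩
    convert h using 1
    omega
  refine ⟨i - Nat.find hex, by omega, Nat.find_spec hex, fun m hm hmi hJ => ?_⟩
  refine Nat.find_min hex (m := (i - m).toNat) (by omega) ?_
  convert hJ
  omega

/-- Past the end of a gap, the current loop and the next one both show `w`. Thus the filling follows
the current loop for `k` more sites, and every pattern starting in the gap is one of that loop. -/
lemma fill_mem_sft {q k : ℕ} {W : Set (Fin k → Fin q)} {w : Fin k → Fin q}
    {loop : ℕ → ℤ → Fin q} (hkN : k ≤ N) (hmem : ∀ t, N ≤ t → loop t ∈ sft q k W)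
    (hstart : ∀ t, N ≤ t → pattern k (loop t) 0 = w)
    (hend : ∀ t : ℕ, N ≤ t → pattern k (loop t) t = w)
    (hnear : ∀ i : ℤ, ∃ d : ℤ, |d| < N ∧ J (i + d))
    (hsep : ∀ (i : ℤ) (d : ℕ), J i → 0 < d → d < N → ¬ J (i + d)) :
    fill N loop J ∈ sft q k W := by
  intro i
  obtain ⟨p, hpi, hp, hlast⟩ := exists_last hnear i
  obtain ⟨t, hNt, htN, hn, hno⟩ := exists_next hnear hsep hp
  obtain ⟨t', hNt', htN', hn', hno'⟩ := exists_next hnear hsep hn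
  have hin : i < p + t := by
    by_contra! h
    obtain ⟨d, hd, -⟩ := hnear 0
    have := (abs_nonneg d).trans_lt hd
    exact hlast _ (by omega) h hn
  have hfill : ∀ v, p < v → v ≤ p + t + k → fill N loop J v = loop t (v - p) := by
    intro v hpv hv
    by_cases hvn : v ≤ p + t
    · exact fill_eq_loop hp hn hno rfl htN hpv hvn
    · rw [fill_eq_loop hn hn' hno' rfl htN' (by omega) (by omega)]
      have h₁ := congrFun ((hstart t' hNt').trans (hend t hNt).symm)
        ⟨(v - (p + t) - 1).toNat, by omega⟩
      simp only [pattern] at h₁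
      convert h₁ using 2
      · omega
      · omega
  have : pattern k (fill N loop J) i = pattern k (loop t) (i - p) := by
    ext1 j
    have := j.2
    rw [pattern, pattern, hfill _ (by omega) (by omega)]
    congr 1
    ring
  rw [this]
  exact hmem t hNt _

end Filling

/-! ### Recurrence times of a non-lattice shift -/

section Loops

variable {q k : ℕ} {W : Set (Fin k → Fin q)} {w : Fin k → Fin q}

/-- Two configurations can be glued along a common occurrence of `w`, since it covers a full window
of length `k`. -/
lemma add_mem_recurrenceTimes {s t : ℕ} (hs : s ∈ recurrenceTimes q k W w)
    (ht : t ∈ recurrenceTimes q k W w) : s + t ∈ recurrenceTimes q k W w := by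
  obtain ⟨hs1, x, hx, hx0, hxs⟩ := hs
  obtain ⟨ht1, x', hx', hx'0, hx't⟩ := ht
  set y : ℤ → Fin q := fun v => if v ≤ s then x v else x' (v - s) with hy
  have hleft : ∀ v : ℤ, v ≤ s + k → y v = x v := by
    intro v hv
    by_cases h : v ≤ s
    · simp only [hy, if_pos h]
    · simp only [hy, if_neg h]
      have h₁ := congrFun (hx'0.trans hxs.symm) ⟨(v - s - 1).toNat, by omega⟩
      simp only [pattern] at h₁
      convert h₁ using 2
      · omega
      · omega
  have hright : ∀ v : ℤ, s < v → y v = x' (v - s) := fun v hv => by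
    simp only [hy, if_neg (not_le.2 hv)]
  have hpl : ∀ i : ℤ, i ≤ s → pattern k y i = pattern k x i := fun i hi => by
    ext1 j
    exact hleft _ (by omega)
  have hpr : ∀ i : ℤ, s ≤ i → pattern k y i = pattern k x' (i - s) := fun i hi => by
    ext1 j
    rw [pattern, pattern, hright _ (by omega)]
    congr 1
    ring
  refine ⟨by omega, y, fun i => ?_, ?_, ?_⟩
  · rcases le_total i s with h | h
    · rw [hpl i h]
      exact hx i
    · rw [hpr i h]
      exact hx' _
  · rw [hpl 0 (by omega), hx0]
  · rw [hpr _ (by push_cast; omega), ← hx't]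
    congr 1
    push_cast
    ring

lemma exists_forall_ge_mem_recurrenceTimes (h : Nat.setGcd (recurrenceTimes q k W w) = 1) :
    ∃ n, ∀ t ≥ n, t ∈ recurrenceTimes q k W w := by
  obtain ⟨n, hn⟩ := Nat.exists_mem_closure_of_ge (recurrenceTimes q k W w)
  refine ⟨n + 1, fun t ht => ?_⟩
  have hmem := hn t (by omega) (by rw [h]; exact one_dvd t)
  have : t = 0 ∨ t ∈ recurrenceTimes q k W w := by
    clear ht
    induction hmem using AddSubmonoid.closure_induction with
    | mem _ h => exact Or.inr h
    | zero => exact Or.inl rfl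
    | add a b _ _ ha hb =>
      rcases ha with rfl | ha
      · simpa using hb
      rcases hb with rfl | hb
      · simpa using Or.inr ha
      · exact Or.inr (add_mem_recurrenceTimes ha hb)
  exact this.resolve_left (by omega)

lemma NonLattice.exists_loops (h : NonLattice q k W) :
    ∃ (N : ℕ) (w : Fin k → Fin q) (loop : ℕ → ℤ → Fin q), 0 < N ∧ k ≤ N ∧
      ∀ t : ℕ, N ≤ t → loop t ∈ sft q k W ∧ pattern k (loop t) 0 = w ∧
        pattern k (loop t) t = w := by
  obtain ⟨w, -, hw⟩ := h
  obtain ⟨n, hn⟩ := exists_forall_ge_mem_recurrenceTimes hw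
  obtain ⟨-, x₀, -⟩ := hn n le_rfl
  have : ∀ t : ℕ, ∃ x : ℤ → Fin q, n ≤ t →
      x ∈ sft q k W ∧ pattern k x 0 = w ∧ pattern k x t = w := by
    intro t
    by_cases ht : n ≤ t
    · obtain ⟨-, x, hx⟩ := hn t ht
      exact ⟨x, fun _ => hx⟩
    · exact ⟨x₀, fun h => absurd h ht⟩
  choose loop hloop using this
  exact ⟨n + k + 1, w, loop, by omega, by omega, fun t ht => hloop t (by omega)⟩

end Loops

/-! ### Palettes grow like towers -/

section PaletteGrowth

lemma le_paletteSize (j : ℕ) : j ≤ paletteSize j := by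
  have hpow : ∀ u : ℕ, 4 ≤ u → 4 * u ≤ 2 ^ u := by
    intro u hu
    induction u, hu using Nat.le_induction with
    | base => norm_num
    | succ u hu ih =>
      rw [pow_succ]
      omega
  induction j with
  | zero => exact Nat.zero_le _
  | succ j ih =>
    have h8 := eight_le_paletteSize j
    have := hpow (paletteSize j / 2) (by omega)
    rw [paletteSize]
    omega

/-- The factor `2 * p + 5` reproduces itself: half the palette is at least `(p + 2) * x`, and `2 ^
((p + 2) * x) ≥ 2 ^ p * exp x` because `2 * log 2 ≥ 1`. -/
lemma mul_exp_le_paletteSize_succ {p j : ℕ} (hp : 6 ≤ p) {x : ℝ} (hx : 1 ≤ x)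
    (h : (2 * p + 5) * x ≤ paletteSize j) :
    (2 * p + 5) * Real.exp x ≤ paletteSize (j + 1) := by
  have hp2 : ∀ p : ℕ, 6 ≤ p → 2 * p + 5 ≤ 2 ^ p := by
    intro p hp
    induction p, hp using Nat.le_induction with
    | base => norm_num
    | succ p hp ih =>
      rw [pow_succ]
      omega
  have h₁ : (2 * p + 5 : ℝ) ≤ 2 ^ p := by exact_mod_cast hp2 p hp
  have hlog : (1 : ℝ) ≤ 2 * Real.log 2 := by linarith [Real.log_two_gt_d9]
  have hlog0 : 0 < Real.log 2 := Real.log_pos (by norm_num)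
  have hhalf : ((p : ℝ) + 2) * x ≤ ((paletteSize j / 2 : ℕ) : ℝ) := by
    have : (paletteSize j : ℝ) ≤ 2 * ((paletteSize j / 2 : ℕ) : ℝ) + 1 := by
      exact_mod_cast (by omega : paletteSize j ≤ 2 * (paletteSize j / 2) + 1)
    nlinarith
  have hexp : ∀ n : ℕ, (2 : ℝ) ^ n = Real.exp (n * Real.log 2) := by
    intro n
    rw [Real.exp_nat_mul, Real.exp_log (by norm_num)]
  rw [paletteSize]
  push_cast
  rw [hexp]
  calc (2 * p + 5) * Real.exp x ≤ Real.exp (p * Real.log 2) * Real.exp x := by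
        rw [← hexp]
        gcongr
    _ = Real.exp (p * Real.log 2 + x) := (Real.exp_add _ _).symm
    _ ≤ Real.exp (((p : ℝ) + 2) * x * Real.log 2) := by
        gcongr
        have h₂ : (p : ℝ) * Real.log 2 ≤ p * Real.log 2 * x :=
          le_mul_of_one_le_right (by positivity) hx
        nlinarith
    _ ≤ _ := by gcongr

lemma one_le_iterate_exp (m : ℕ) : 1 ≤ Real.exp^[m] 1 := le_iterate_exp 1 m

lemma exists_mul_iterate_exp_le_paletteSize (K : ℕ) :
    ∃ j₀ : ℕ, ∀ m : ℕ, K * Real.exp^[m] 1 ≤ paletteSize (j₀ + m) := by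
  set p := K + 6
  have h : ∀ m : ℕ, (2 * p + 5 : ℝ) * Real.exp^[m] 1 ≤ paletteSize (2 * p + 5 + m) := by
    intro m
    induction m with
    | zero =>
      simp only [Function.iterate_zero, id, mul_one, add_zero]
      exact_mod_cast le_paletteSize (2 * p + 5)
    | succ m ih =>
      rw [Function.iterate_succ_apply', ← add_assoc]
      exact mul_exp_le_paletteSize_succ (by omega) (one_le_iterate_exp m) ih
  refine ⟨2 * p + 5, fun m => le_trans ?_ (h m)⟩
  have := one_le_iterate_exp m
  have hK : (K : ℝ) ≤ 2 * p + 5 := by exact_mod_cast (by omega : K ≤ 2 * p + 5)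
  gcongr

end PaletteGrowth

/-! ### Random labels and their levels -/

section Labels

/-- A label proposes a colour at every level. -/
abbrev Label : Type := (j : ℕ) → Fin (paletteSize j)

instance (j : ℕ) : NeZero (paletteSize j) := ⟨by have := eight_le_paletteSize j; omega⟩

/-- The law of a label, whose colours are independent and uniformly distributed. -/
noncomputable def labelLaw : Measure Label :=
  Measure.infinitePi fun j => uniformOn (Set.univ : Set (Fin (paletteSize j)))

instance : IsProbabilityMeasure labelLaw := by
  rw [labelLaw]
  infer_instance

lemma labelLaw_apply_eq (j : ℕ) (c : Fin (paletteSize j)) :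
    labelLaw {b | b j = c} = (paletteSize j : ℝ≥0∞)⁻¹ := by
  have := (measurePreserving_eval_infinitePi
    (fun j => uniformOn (Set.univ : Set (Fin (paletteSize j)))) j).measure_preimage
    (MeasurableSet.of_discrete (s := {c})).nullMeasurableSet
  rw [uniformOn_univ, Measure.count_singleton, Fintype.card_fin, one_div] at this
  exact this

lemma iidLaw_labelLaw_eq {u v : ℤ} (huv : u ≠ v) (j : ℕ) :
    iidLaw labelLaw {y | y u j = y v j} = (paletteSize j : ℝ≥0∞)⁻¹ := by
  have hE : MeasurableSet {p : Label × Label | p.1 j = p.2 j} :=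
    measurableSet_eq_fun ((measurable_pi_apply j).comp measurable_fst)
      ((measurable_pi_apply j).comp measurable_snd)
  have h := Measure.infinitePi_map_eval_prod (P := fun _ : ℤ => labelLaw) huv
  have hm : Measurable fun y : ℤ → Label => (y u, y v) := by fun_prop
  have h₁ : iidLaw labelLaw {y | y u j = y v j} =
      (labelLaw.prod labelLaw) {p : Label × Label | p.1 j = p.2 j} := by
    rw [← h, Measure.map_apply hm hE]
    rfl
  rw [h₁, Measure.prod_apply hE]
  have : ∀ a : Label, labelLaw (Prod.mk a ⁻¹' {p : Label × Label | p.1 j = p.2 j}) =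
      (paletteSize j : ℝ≥0∞)⁻¹ := by
    intro a
    rw [← labelLaw_apply_eq j (a j)]
    congr 1
    ext b
    exact eq_comm
  rw [lintegral_congr this]
  simp

/-- The colour that `y i` proposes at level `j` differs from those that the labels at distance less
than `N` propose. -/
def Separated (N : ℕ) (y : ℤ → Label) (i : ℤ) (j : ℕ) : Prop :=
  ∀ d : ℤ, d ≠ 0 → |d| < N → y i j ≠ y (i + d) j

lemma exists_separated_or (N : ℕ) (y : ℤ → Label) (i : ℤ) :
    ∃ j, Separated N y i j ∨ ∀ j', ¬ Separated N y i j' := by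
  by_cases h : ∃ j, Separated N y i j
  · exact h.imp fun _ => Or.inl
  · exact ⟨0, Or.inr (not_exists.1 h)⟩

open Classical in
/-- The first level at which the label at `i` is separated from its neighbours, or `0` if there is
none. -/
noncomputable def level (N : ℕ) (y : ℤ → Label) (i : ℤ) : ℕ := Nat.find (exists_separated_or N y i)

/-- The levels and the colours that the labels propose at these levels. -/
noncomputable def coded (N : ℕ) (y : ℤ → Label) (i : ℤ) : ℕ × ℕ :=
  (level N y i, (y i (level N y i)).val)

variable {N : ℕ}

lemma level_le_of_separated {y : ℤ → Label} {i : ℤ} {j : ℕ} (h : Separated N y i j) :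
    level N y i ≤ j := by
  classical
  exact Nat.find_min' _ (Or.inl h)

lemma separated_level {y : ℤ → Label} {i : ℤ} (h : ∃ j, Separated N y i j) :
    Separated N y i (level N y i) := by
  classical
  exact (Nat.find_spec (exists_separated_or N y i)).resolve_right (not_forall_not.2 h)

lemma properlyColoured_coded {y : ℤ → Label} (h : ∀ i, ∃ j, Separated N y i j) :
    ProperlyColoured N (coded N y) := by
  refine ⟨fun i => Fin.is_lt _, fun i d hd hdN heq => ?_⟩
  have h₁ : level N y i = level N y (i + d) := congrArg Prod.fst heq
  have h₂ : (y i (level N y i)).val = (y (i + d) (level N y (i + d))).val := congrArg Prod.snd heq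
  rw [← h₁] at h₂
  exact separated_level (h i) d (by omega) (by rw [Nat.abs_cast]; exact_mod_cast hdN) (Fin.ext h₂)

lemma coded_congr {y y' : ℤ → Label} {i i' : ℤ} (h : Agree y y' i i' N) :
    coded N y i = coded N y' i' := by
  have hs : ∀ j, Separated N y i j ↔ Separated N y' i' j := fun j => by
    refine forall₃_congr fun d _ hd => ?_
    rw [h.eq, h d hd.le]
  have hl : level N y i = level N y' i' := by
    classical
    exact Nat.find_congr' (by simp only [hs, implies_true])
  rw [coded, coded, hl, h.eq]

lemma agree_coded {y y' : ℤ → Label} {i i' : ℤ} {ρ : ℕ} (h : Agree y y' i i' (ρ + N)) :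
    Agree (coded N y) (coded N y') i i' ρ := by
  intro d hd
  refine coded_congr (h.shift ?_)
  push_cast
  linarith

lemma measurableSet_separated (i : ℤ) (j : ℕ) : MeasurableSet {y | Separated N y i j} := by
  have : {y : ℤ → Label | Separated N y i j} =
      ⋂ (d : ℤ) (_ : d ≠ 0) (_ : |d| < N), {y | y i j = y (i + d) j}ᶜ := by
    ext y
    simp [Separated]
  rw [this]
  refine MeasurableSet.iInter fun d => MeasurableSet.iInter fun _ => MeasurableSet.iInter fun _ =>
    MeasurableSet.compl (measurableSet_eq_fun ?_ ?_)
  · exact (measurable_pi_apply j).comp (measurable_pi_apply i)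
  · exact (measurable_pi_apply j).comp (measurable_pi_apply (i + d))

lemma measurable_level (i : ℤ) : Measurable fun y => level N y i := by
  classical
  refine measurable_find _ fun j => ?_
  have : {y : ℤ → Label | Separated N y i j ∨ ∀ j', ¬ Separated N y i j'} =
      {y | Separated N y i j} ∪ ⋂ j', {y | Separated N y i j'}ᶜ := by
    ext y
    simp
  rw [this]
  exact (measurableSet_separated i j).union
    (MeasurableSet.iInter fun j' => (measurableSet_separated i j').compl)

lemma measurable_coded : Measurable (coded N) := by
  refine measurable_pi_lambda _ fun i => (measurable_level i).prodMk ?_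
  refine measurable_to_countable' fun m => ?_
  have : (fun y : ℤ → Label => (y i (level N y i)).val) ⁻¹' {m} =
      ⋃ j, (fun y => level N y i) ⁻¹' {j} ∩ {y | (y i j).val = m} := by
    ext y
    simp
  rw [this]
  refine MeasurableSet.iUnion fun j => (measurable_level i (measurableSet_singleton j)).inter ?_
  have hm : Measurable fun y : ℤ → Label => y i j :=
    (measurable_pi_apply j).comp (measurable_pi_apply i)
  exact hm (MeasurableSet.of_discrete (s := {c : Fin (paletteSize j) | c.val = m}))

lemma measure_not_separated_le (i : ℤ) (j : ℕ) :
    iidLaw labelLaw {y | ¬ Separated N y i j} ≤ (2 * N + 1 : ℕ) * (paletteSize j : ℝ≥0∞)⁻¹ := by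
  have hsub : {y : ℤ → Label | ¬ Separated N y i j} ⊆
      ⋃ d ∈ (Finset.Icc (-N : ℤ) N).filter (· ≠ 0), {y | y i j = y (i + d) j} := by
    intro y hy
    simp only [Separated, Set.mem_ofPred_eq, not_forall, not_not] at hy
    obtain ⟨d, hd, hdN, h⟩ := hy
    rw [abs_lt] at hdN
    simp only [Set.mem_iUnion, Finset.mem_filter, Finset.mem_Icc]
    exact ⟨d, ⟨⟨by omega, by omega⟩, hd⟩, h⟩
  refine (measure_mono hsub).trans ((measure_biUnion_finset_le _ _).trans ?_)
  rw [Finset.sum_congr rfl (g := fun _ => (paletteSize j : ℝ≥0∞)⁻¹), Finset.sum_const,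
    nsmul_eq_mul]
  · gcongr
    refine (Finset.card_filter_le _ _).trans ?_
    rw [Int.card_Icc]
    omega
  · intro d hd
    have := (Finset.mem_filter.1 hd).2
    exact iidLaw_labelLaw_eq (by omega) j

lemma ae_exists_separated : ∀ᵐ y ∂iidLaw labelLaw, ∀ i, ∃ j, Separated N y i j := by
  rw [ae_all_iff]
  intro i
  rw [ae_iff]
  have hle : ∀ j : ℕ, iidLaw labelLaw {y | ¬ ∃ j, Separated N y i j} ≤
      (2 * N + 1 : ℕ) * (j : ℝ≥0∞)⁻¹ := fun j =>
    (measure_mono fun y hy => not_exists.1 hy j).trans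
      ((measure_not_separated_le i j).trans (by gcongr; exact le_paletteSize j))
  have htend : Filter.Tendsto (fun j : ℕ => ((2 * N + 1 : ℕ) : ℝ≥0∞) * (j : ℝ≥0∞)⁻¹)
      Filter.atTop (nhds 0) := by
    simpa using ENNReal.Tendsto.const_mul ENNReal.tendsto_inv_nat_nhds_zero
      (Or.inr (ENNReal.natCast_ne_top (2 * N + 1)))
  exact le_antisymm (ge_of_tendsto' htend hle) zero_le

end Labels

/-! ### The finitary factor and its coding radius -/

section Construction

variable {q k N : ℕ} (loop : ℕ → ℤ → Fin q)

/-- The finitary factor that fills in loops between the vertices selected by the labels. -/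
noncomputable def loopFactor (N : ℕ) (y : ℤ → Label) : ℤ → Fin q :=
  fill N loop (Selected N (coded N y))

variable {loop}

/-- Comparing two configurations around two sites yields measurability, equivariance and the coding
radius at once. -/
lemma fill_selected_congr {z z' : ℤ → ℕ × ℕ} {i i' : ℤ} {M : ℕ}
    (hM : ∀ e : ℤ, |e| ≤ (2 * N : ℕ) → rank N z (i + e) < M)
    (h : Agree z z' i i' (N * M + 2 * N)) :
    fill N loop (Selected N z) i = fill N loop (Selected N z') i' := by
  refine fill_congr fun e he => selected_congr ((h.shift (σ := N * M) ?_).mono ?_)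
  · push_cast at he ⊢
    linarith
  · exact Nat.mul_le_mul_left _ (hM e he)

lemma exists_rank_lt (z : ℤ → ℕ × ℕ) (i : ℤ) (r : ℕ) :
    ∃ M, ∀ e : ℤ, |e| ≤ r → rank N z (i + e) < M := by
  have hfin : Set.Finite {e : ℤ | |e| ≤ r} := by
    refine (Set.finite_Icc (-r : ℤ) r).subset fun e he => abs_le.1 he
  obtain ⟨M, hM⟩ := (hfin.image fun e => rank N z (i + e)).bddAbove
  exact ⟨M + 1, fun e he => Nat.lt_succ_of_le (hM ⟨e, he, rfl⟩)⟩

lemma measurable_fill_selected (v : ℤ) :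
    Measurable fun z : ℤ → ℕ × ℕ => fill N loop (Selected N z) v := by
  refine (IsLocallyConstant.continuous ?_).measurable
  rw [IsLocallyConstant.iff_exists_open]
  intro z
  obtain ⟨M, hM⟩ := exists_rank_lt (N := N) z v (2 * N)
  set r : ℕ := N * M + 2 * N with hr
  refine ⟨Set.pi (Set.Icc (v - r) (v + r)) fun i => {z i},
    isOpen_set_pi (Set.finite_Icc _ _) fun i _ => isOpen_discrete _, fun i _ => rfl, ?_⟩
  intro z' hz'
  refine (fill_selected_congr hM fun d hd => ?_).symm
  rw [abs_le] at hd
  exact (hz' (v + d) ⟨by omega, by omega⟩).symm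

lemma measurable_loopFactor : Measurable (loopFactor loop N) :=
  measurable_pi_lambda _ fun v => (measurable_fill_selected v).comp measurable_coded

lemma loopFactor_translate (t : ℤ) (y : ℤ → Label) :
    loopFactor loop N (translate t y) = translate t (loopFactor loop N y) := by
  ext1 v
  obtain ⟨M, hM⟩ := exists_rank_lt (N := N) (coded N (translate t y)) v (2 * N)
  refine fill_selected_congr hM (agree_coded fun d _ => ?_)
  rw [translate]
  congr 1
  ring

lemma determinedBy_loopFactor {y : ℤ → Label} {M r : ℕ}
    (hM : ∀ e : ℤ, |e| ≤ (2 * N : ℕ) → rank N (coded N y) e < M) (hr : N * M + 2 * N + N ≤ r) :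
    DeterminedBy (loopFactor loop N) y r := by
  intro y' hy'
  refine (fill_selected_congr (M := M) (fun e he => ?_) (agree_coded fun d hd => ?_)).symm
  · rw [zero_add]
    exact hM e he
  · rw [zero_add]
    exact (hy' d (hd.trans (by exact_mod_cast hr))).symm

lemma determinedBy_loopFactor_of_level_le {y : ℤ → Label} {L r : ℕ}
    (hL : ∀ e : ℤ, |e| ≤ (2 * N : ℕ) → level N y e ≤ L)
    (hr : N * ((L + 1) * 8 ^ N + 3) ≤ r) : DeterminedBy (loopFactor loop N) y r := by
  refine determinedBy_loopFactor (M := (L + 1) * 8 ^ N) (fun e he => ?_) (le_trans ?_ hr)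
  · exact (rank_lt e).trans_le (Nat.mul_le_mul_right _ (Nat.succ_le_succ (hL e he)))
  · exact le_of_eq (by ring)

/-- A large coding radius requires one of the `4 * N + 1` sites within distance `2 * N` to fail
separation at level `L`, and each failure is a collision with one of its neighbours. -/
lemma measure_not_determinedBy_loopFactor_le {L r : ℕ} (hr : N * ((L + 1) * 8 ^ N + 3) ≤ r) :
    (iidLaw labelLaw).real {y | ¬ DeterminedBy (loopFactor loop N) y r} ≤
      ((4 * N + 1) * (2 * N + 1) : ℕ) / paletteSize L := by
  have hsub : {y : ℤ → Label | ¬ DeterminedBy (loopFactor loop N) y r} ⊆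
      ⋃ e ∈ Finset.Icc (-(2 * N : ℕ) : ℤ) (2 * N : ℕ), {y | ¬ Separated N y e L} := by
    intro y hy
    by_contra h
    simp only [Set.mem_iUnion, Finset.mem_Icc, Set.mem_ofPred_eq, not_exists, not_not] at h
    exact hy (determinedBy_loopFactor_of_level_le
      (fun e he => level_le_of_separated (h e (abs_le.1 he))) hr)
  have hle : iidLaw labelLaw {y : ℤ → Label | ¬ DeterminedBy (loopFactor loop N) y r} ≤
      ((4 * N + 1) * (2 * N + 1) : ℕ) * (paletteSize L : ℝ≥0∞)⁻¹ := by
    refine (measure_mono hsub).trans ((measure_biUnion_finset_le _ _).trans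
      ((Finset.sum_le_sum fun e _ => measure_not_separated_le e L).trans ?_))
    rw [Finset.sum_const, nsmul_eq_mul, ← mul_assoc, ← Nat.cast_mul]
    gcongr
    rw [Int.card_Icc]
    omega
  have htop : ((4 * N + 1) * (2 * N + 1) : ℕ) * (paletteSize L : ℝ≥0∞)⁻¹ ≠ ⊤ :=
    ENNReal.mul_ne_top (ENNReal.natCast_ne_top _)
      (ENNReal.inv_ne_top.2 (Nat.cast_ne_zero.2 (NeZero.ne _)))
  have := ENNReal.toReal_mono htop hle
  rwa [ENNReal.toReal_mul, ENNReal.toReal_inv, ENNReal.toReal_natCast, ENNReal.toReal_natCast,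
    ← div_eq_mul_inv] at this

end Construction

theorem exists_tail_le_tower {q k : ℕ} {W : Set (Fin k → Fin q)} (hW : NonLattice q k W) :
    ∃ c : ℝ, 0 < c ∧
      ∃ (Ω : Type) (_ : MeasurableSpace Ω) (B : Type) (_ : MeasurableSpace B)
        (P : Measure Ω) (X : Ω → ℤ → Fin q) (Y : ℤ → Ω → B) (F : (ℤ → B) → ℤ → Fin q),
        IsFFIID P X Y F ∧ (∀ᵐ ω ∂P, X ω ∈ sft q k W) ∧
        ∀ r : ℝ, 0 < r → tail P Y F r ≤ 1 / tower (c * r) := by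
  obtain ⟨N, w, loop, hN, hkN, hloop⟩ := hW.exists_loops
  obtain ⟨j₀, hj₀⟩ := exists_mul_iterate_exp_le_paletteSize ((4 * N + 1) * (2 * N + 1))
  -- This is the radius needed for level `j₀ + 1`; for `m ≥ 1`, level `j₀ + m` needs at most `m *
  -- D`.
  set D : ℕ := N * ((j₀ + 2) * 8 ^ N + 3) with hD
  have hD0 : 0 < D := by positivity
  have hlaw : law (iidLaw labelLaw) (fun v (y : ℤ → Label) => y v) = iidLaw labelLaw :=
    Measure.map_id
  refine ⟨(D : ℝ)⁻¹, by positivity, ℤ → Label, inferInstance, Label, inferInstance,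
    iidLaw labelLaw, loopFactor loop N, fun v y => y v, loopFactor loop N, ?_, ?_, ?_⟩
  · refine ⟨inferInstance, measurable_pi_apply, ?_, ?_, measurable_loopFactor,
      loopFactor_translate, fun _ => rfl, ?_⟩
    · exact iIndepFun_infinitePi (P := fun _ : ℤ => labelLaw) (X := fun _ b => b)
        fun _ => measurable_id
    · intro u v
      refine ⟨(measurable_pi_apply u).aemeasurable, (measurable_pi_apply v).aemeasurable, ?_⟩
      rw [(measurePreserving_eval_infinitePi (fun _ : ℤ => labelLaw) u).map_eq,
        (measurePreserving_eval_infinitePi (fun _ : ℤ => labelLaw) v).map_eq]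
    · refine Filter.Eventually.of_forall fun y => ?_
      obtain ⟨M, hM⟩ := exists_rank_lt (N := N) (coded N y) 0 (2 * N)
      have hdet : DeterminedBy (loopFactor loop N) y (N * M + 2 * N + N) :=
        determinedBy_loopFactor (fun e he => by simpa using hM e he) le_rfl
      exact (codingRadius_le_iff.2 hdet).trans_lt (ENat.natCast_lt_top _)
  · filter_upwards [ae_exists_separated (N := N)] with y hy
    have hz := properlyColoured_coded hy
    exact fill_mem_sft hkN (fun t ht => (hloop t ht).1) (fun t ht => (hloop t ht).2.1)
      (fun t ht => (hloop t ht).2.2) (exists_selected_near hN)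
      fun i d hi hd hdN => hz.not_selected_add hi hd hdN
  · intro r hr
    have htail : tail (iidLaw labelLaw) (fun v (y : ℤ → Label) => y v) (loopFactor loop N) r =
        (iidLaw labelLaw).real {y | ¬ DeterminedBy (loopFactor loop N) y ⌊r⌋₊} := by
      rw [tail, hlaw]
      congr 1
      ext y
      exact ofReal_lt_codingRadius_iff hr.le
    rw [htail, tower]
    rcases lt_or_ge ((D : ℝ)⁻¹ * r) 1 with h1 | h1
    · rw [Nat.floor_eq_zero.2 h1]
      simp
    · set m := ⌊(D : ℝ)⁻¹ * r⌋₊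
      have hm1 : 1 ≤ m := Nat.le_floor (by rwa [Nat.cast_one])
      have hm : (m : ℝ) * D ≤ r := by
        have := Nat.floor_le (by linarith : 0 ≤ (D : ℝ)⁻¹ * r)
        calc (m : ℝ) * D ≤ (D : ℝ)⁻¹ * r * D := by gcongr
          _ = r := by field_simp
      have hmD : N * ((j₀ + m + 1) * 8 ^ N + 3) ≤ ⌊r⌋₊ := by
        refine Nat.le_floor (le_trans ?_ hm)
        norm_cast
        rw [hD, mul_left_comm]
        gcongr
        rw [mul_add, ← mul_assoc]
        gcongr
        · nlinarith
        · omega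
      refine (measure_not_determinedBy_loopFactor_le hmD).trans ?_
      have hpos : 0 < Real.exp^[m] 1 := zero_lt_one.trans_le (one_le_iterate_exp m)
      rw [div_le_div_iff₀ (Nat.cast_pos.2 (NeZero.pos _)) hpos, one_mul]
      exact hj₀ m

end FiniteType

theorem theorem3 (q k : ℕ) (W : Set (Fin k → Fin q)) :
    (FiniteType.NonLattice q k W →
      ∃ c : ℝ, 0 < c ∧
        ∃ (Ω : Type) (_ : MeasurableSpace Ω) (B : Type) (_ : MeasurableSpace B)
          (P : Measure Ω) (X : Ω → ℤ → Fin q) (Y : ℤ → Ω → B) (F : (ℤ → B) → ℤ → Fin q),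
          FiniteType.IsFFIID P X Y F ∧
          (∀ᵐ ω ∂P, X ω ∈ FiniteType.sft q k W) ∧
          ∀ r : ℝ, 0 < r → FiniteType.tail P Y F r ≤ 1 / FiniteType.tower (c * r)) ∧
    ((∀ a : Fin q, (fun _ : ℤ => a) ∉ FiniteType.sft q k W) →
      ∃ C : ℝ, 0 < C ∧
        ∀ (Ω : Type*) [MeasurableSpace Ω] (B : Type*) [MeasurableSpace B]
          (P : Measure Ω) (X : Ω → ℤ → Fin q) (Y : ℤ → Ω → B) (F : (ℤ → B) → ℤ → Fin q),
          FiniteType.IsFFIID P X Y F →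
          (∀ᵐ ω ∂P, X ω ∈ FiniteType.sft q k W) →
          ∀ r : ℝ, 0 < r → 1 / FiniteType.tower (C * r) ≤ FiniteType.tail P Y F r) :=
  ⟨FiniteType.exists_tail_le_tower, FiniteType.exists_tower_le_tail q k W⟩
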